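/- **Model.** Let $G$ be a finite simple graph (the static network) whose vertices are agents. Each agent $v$ acts in consecutive rounds $(v,0),(v,1),\dots$; round $(v,j)$ occupies the time interval $[t_{v,j},t_{v,j+1})$. The start times $t_{v,0}\le 0$ of the first rounds are fixed and may differ. All round durations $t_{v,j+1}-t_{v,j}$ lie in $[T_{\min},T_{\max}]$, where $T_{\min}>0$. The duration of a round is determined before the round begins: it may depend arbitrarily on everything that happened strictly before $t_{v,j}$ (in particular on all transmissions sent and received so far), but not on the random choices made at or after its start. A note sung by $u$ at time $\tau$ is heard by each neighbour $v$ at time $\tau+\delta_{u,v}(\tau)$, where $0\le\delta_{u,v}(\tau)\le\Delta_{\max}$; the delays may vary with time and with the pair of agents, but do not depend on the notes sung. Assume $2\Delta_{\max}\le T_{\min}$. **Singing protocol.** Every agent is in state In, Out or Un, and starts in state Un. At the beginning of each round $(v,j)$ the agent flips fair independent coins until the first $0$; $\ell_{v,j}\ge 1$ is the number of flips. Throughout the round an Out agent is silent, an In agent sings note $0$, and an Un agent sings notes $1,\dots,\ell_{v,j}$. A note is heard in round $(v,j)$ if it was sung by a neighbour at a time before $t_{v,j+1}$ and arrives at a time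 in $[t_{v,j},t_{v,j+1}]$. At the end of the round: an In agent becomes Un if it heard note $0$, and stays In otherwise; an Un agent becomes Out if it heard note $0$, otherwise stays Un if it heard note $\ell_{v,j}$, and otherwise becomes In; an Out agent stays Out if it heard note $0$, and becomes Un otherwise. An agent is *eliminated* at time $t$ if it, or one of its neighbours, is at time $t$ in state In without having a neighbour in state In. An edge is *active* at time $t$ if neither endpoint is eliminated at time $t$; ${\cal E}_t$ is the set of active edges. **Theorem.** Let $T_{\rm diff}=2\Delta_{\max}+3T_{\max}$. 1. For every time $t\ge 0$, and conditionally on every possible history up to time $t$ (the start times and $\ell$-values of all rounds that start at or before time $t$; every history that occurs has positive probability, and it determines ${\cal E}_t$), $$|{\cal E}_t|-\mathbb E\big[\,|{\cal E}_{t+T_{\rm diff}}|\,\big]\;\ge\;\frac{|{\cal E}_t|}{28}\cdot\frac{T_{\min}}{T_{\rm diff}},$$ where the expectation is over the random choices made in rounds that start after time $t$. 2. Measured in units of $T_{\max}$, the protocol converges to a maximal independent set in time $O(\log n\cdot T_{\max}/T_{\min})$ with high probability: there is an absolute constant $C>0$ such that for every network with $n\ge 2$ agents, all parameters, round durations and delays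 as above, and every real $c\ge 1$, with probability at least $1-n^{-c}$ there is a maximal independent set $I$ of $G$ such that at all times $\ge C\,c\,\log n\cdot\frac{T_{\max}}{T_{\min}}\cdot T_{\max}$ every agent of $I$ is in state In and every other agent is in state Out. -/

import Mathlib

open MeasureTheory

namespace Singing

/-- The three states of an agent: out of the independent set, in it, or undecided. -/
inductive AgentState
  | out
  | isIn
  | un

/-- The sample space: `ω (v, j, m)` is the outcome of the `m`-th coin flip (`m = 0, 1, 2, …`) of
agent `v` at the beginning of its round `j`, with `true` for `1` and `false` for `0`. -/
abbrev Coins (V : Type*) : Type _ := V × ℕ × ℕ → Bool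

/-- All coin flips are fair and independent. -/
noncomputable def coinMeasure (V : Type*) : Measure (Coins V) :=
  Measure.infinitePi fun _ : V × ℕ × ℕ => (PMF.uniformOfFintype Bool).toMeasure

instance coinMeasure_isProbabilityMeasure (V : Type*) :
    IsProbabilityMeasure (coinMeasure V) := by
  unfold coinMeasure
  infer_instance

/-- The `ℓ`-value of agent `v` in round `j`: the number of flips up to and including the first `0`.
(On the null event that no flip gives `0`, the value is `1`.) -/
noncomputable def ell {V : Type*} (ω : Coins V) (v : V) (j : ℕ) : ℕ :=
  sInf {m : ℕ | ω (v, j, m) = false} + 1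

/-- The notes sung during a round by an agent in state `s` whose `ℓ`-value is `l`. -/
def notes (s : AgentState) (l : ℕ) : Set ℕ :=
  match s with
  | .out => ∅
  | .isIn => {0}
  | .un => Set.Icc 1 l

open Classical in
/-- The state for the next round of an agent in state `s`, where `heardZero` says that it heard
note `0` in the round, and `heardOwn` that it heard the note equal to its own `ℓ`-value. -/
noncomputable def nextState (s : AgentState) (heardZero heardOwn : Prop) : AgentState :=
  match s with
  | .isIn => if heardZero then .un else .isIn
  | .un => if heardZero then .out else if heardOwn then .un else .isIn
  | .out => if heardZero then .out else .un

section Network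

variable {V : Type*}

/-- Agent `v` is in its round `j` at time `τ`, where `start v j` is the start time of round `j`
of `v`, which is also the end time of its round `j - 1`. -/
def InRound (start : V → ℕ → ℝ) (v : V) (j : ℕ) (τ : ℝ) : Prop :=
  start v j ≤ τ ∧ τ < start v (j + 1)

/-- Agent `u` is singing note `k` at time `τ`. -/
def Sings (start : V → ℕ → ℝ) (state : V → ℕ → AgentState) (l : V → ℕ → ℕ)
    (u : V) (τ : ℝ) (k : ℕ) : Prop :=
  ∃ i, InRound start u i τ ∧ k ∈ notes (state u i) (l u i)

/-- Agent `v` hears note `k` in its round `j`. What a neighbour `u` sings at time `τ` reaches `v` at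
time `τ + delay u v τ`, and it is heard in round `j` if it arrives in the course of the round, up to
and including the end of the round. What is sung only once the round has ended does not count. -/
def Hears (G : SimpleGraph V) (delay : V → V → ℝ → ℝ) (start : V → ℕ → ℝ)
    (state : V → ℕ → AgentState) (l : V → ℕ → ℕ) (v : V) (j : ℕ) (k : ℕ) : Prop :=
  ∃ u, G.Adj u v ∧ ∃ τ, τ < start v (j + 1) ∧
    τ + delay u v τ ∈ Set.Icc (start v j) (start v (j + 1)) ∧ Sings start state l u τ k

open Classical in
/-- What has happened strictly before time `t`: the start times and the `ℓ`-values of all rounds of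
all agents that have started before `t`. -/
noncomputable def historyBefore (start : V → ℕ → Coins V → ℝ) (t : ℝ) (ω : Coins V) :
    V → ℕ → Option (ℝ × ℕ) :=
  fun u i => if start u i ω < t then some (start u i ω, ell ω u i) else none

open Classical in
/-- What has happened up to and including time `t`: the start times and the `ℓ`-values of all rounds
of all agents that have started by time `t`. -/
noncomputable def historyUpTo (start : V → ℕ → Coins V → ℝ) (t : ℝ) (ω : Coins V) :
    V → ℕ → Option (ℝ × ℕ) :=
  fun u i => if start u i ω ≤ t then some (start u i ω, ell ω u i) else none

/-- An execution of the singing protocol on the static network `G` with asynchronous rounds: all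
round durations lie in `[Tmin, Tmax]`, and all delays between neighbours in `[0, Δmax]`. -/
structure Execution (G : SimpleGraph V) (Tmin Tmax Δmax : ℝ) where
  /-- `delay u v τ` is the delay of what `u` sings at time `τ` on its way to `v`. It may vary over
  time and between agents, but does not depend on the notes that are sung. -/
  delay : V → V → ℝ → ℝ
  /-- `start v j ω` is the start time of round `j` of agent `v`. -/
  start : V → ℕ → Coins V → ℝ
  /-- `state v j ω` is the state of agent `v` during its round `j`. -/
  state : V → ℕ → Coins V → AgentState
  delay_mem : ∀ u v τ, G.Adj u v → delay u v τ ∈ Set.Icc 0 Δmax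
  /-- The first rounds start at arbitrary times that do not depend on the coins; all agents are
  present from time `0` on. -/
  start_zero : ∀ v, ∃ a ≤ (0 : ℝ), ∀ ω, start v 0 ω = a
  duration_mem : ∀ v j ω, start v (j + 1) ω - start v j ω ∈ Set.Icc Tmin Tmax
  /-- The duration of a round is fixed before the round begins: it may depend in any way on what has
  happened before, but not on the `ℓ`-value of that round or of a round that starts at the same time
  or later. -/
  nonanticipating : ∀ v j ω ω', start v j ω = start v j ω' →
    historyBefore start (start v j ω) ω = historyBefore start (start v j ω') ω' →
    start v (j + 1) ω = start v (j + 1) ω'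
  /-- All agents start in the undecided state. -/
  state_zero : ∀ v ω, state v 0 ω = .un
  /-- At the end of a round, the agent updates its state according to the notes that it heard. -/
  state_succ : ∀ v j ω, state v (j + 1) ω =
    nextState (state v j ω)
      (Hears G delay (start · · ω) (state · · ω) (ell ω) v j 0)
      (Hears G delay (start · · ω) (state · · ω) (ell ω) v j (ell ω v j))

namespace Execution

variable {G : SimpleGraph V} {Tmin Tmax Δmax : ℝ} (X : Execution G Tmin Tmax Δmax)

/-- Agent `v` is in state `s` at time `t`. -/
def StateAt (t : ℝ) (ω : Coins V) (v : V) (s : AgentState) : Prop :=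
  ∃ j, InRound (X.start · · ω) v j t ∧ X.state v j ω = s

/-- At time `t`, agent `v` is in state `In` and has no neighbour in state `In`. -/
def InUnconflicted (t : ℝ) (ω : Coins V) (v : V) : Prop :=
  X.StateAt t ω v .isIn ∧ ∀ u, G.Adj v u → ¬ X.StateAt t ω u .isIn

/-- Agent `v` is eliminated at time `t`. -/
def Eliminated (t : ℝ) (ω : Coins V) (v : V) : Prop :=
  X.InUnconflicted t ω v ∨ ∃ u, G.Adj v u ∧ X.InUnconflicted t ω u

/-- The set of edges that are active at time `t`: neither endpoint is eliminated. -/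
def activeEdges (t : ℝ) (ω : Coins V) : Set (Sym2 V) :=
  {e | e ∈ G.edgeSet ∧ ∀ v ∈ e, ¬ X.Eliminated t ω v}

/-- The number of edges that are active at time `t`, as a real number. -/
noncomputable def numActive (t : ℝ) (ω : Coins V) : ℝ :=
  ((X.activeEdges t ω).ncard : ℝ)

/-- The event that the history up to time `t` is the one that occurs in the outcome `ω₀`. -/
def sameHistory (t : ℝ) (ω₀ : Coins V) : Set (Coins V) :=
  {ω | historyUpTo X.start t ω = historyUpTo X.start t ω₀}

/-- The protocol has converged to a maximal independent set by time `t`: from then on, each member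
of the set is in state `In`, and each other agent is in state `Out`, forever. -/
def ConvergedBy (t : ℝ) (ω : Coins V) : Prop :=
  ∃ I : Set V, Maximal G.IsIndepSet I ∧ ∀ t' ≥ t, ∀ v,
    (v ∈ I → X.StateAt t' ω v .isIn) ∧ (v ∉ I → X.StateAt t' ω v .out)

end Execution

end Network

end Singing

/-!
The singing protocol on a network with asynchronous rounds loses, in every period of length
`Tdiff = 2 * Δmax + 3 * Tmax`, an expected constant times `Tmin / Tdiff` of its active edges, and
so converges to a maximal independent set in logarithmic time.

**Safety.** Adjacent agents are never both in state In, not even at different times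
(`not_both_isIn`). In a counterexample that is earliest in time, if both turned In less than `Δmax`
apart, then each heard the last undecided round of the other and so had the larger `ℓ`-value; if
not, the later one heard note `0`. So state In is never left, elimination is permanent, only
undecided agents are not eliminated, and the neighbours of an agent in state In soon stay Out
(`out_of_inBy_adj`).

**Joining.** Fix a time `t` and a vertex `v` that is not eliminated, and consider the first round of
`v` that starts after the neighbours eliminated at time `t` have become inaudible, that is, at or
after `t + 2 * Δmax + Tmax`. If its `ℓ`-value beats the rounds of the other neighbours that start
between `t` and `t + Tdiff`, and `v` is not eliminated up to `Δmax` after its start, then `v` joins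
the independent set (`isIn_succ_of_wins`).

**Probability.** Round durations may depend on earlier `ℓ`-values, but rounds that start at or
before the start of a given round do not depend on its `ℓ`-value (`AgreeBefore.start_eq_and`). So
the `ℓ`-value of the decisive round of `v` is geometric and independent of which round it is. The
rivals of `v` for a neighbour `u` are the next `K = ⌈Tdiff / Tmin⌉` rounds of all other agents that
are adjacent to `u` or `v` by an active edge, at most `m = K * (d u + d v)` rounds in number. With a
threshold `k` such that `2 ^ k` is between `2 * m` and `4 * m`, the event that the `ℓ`-value of `v`
exceeds `k` and those of its rivals do not has probability at least `1 / (8 * m)`. The elimination of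
`v` up to `Δmax` after the start of the round is not independent of this event, but lowering the
`ℓ`-value of `v` to `1` preserves it (`elimBy_of_ell_le`), so a large `ℓ`-value at most doubles its
probability. Altogether, `v` eliminates `u` with probability at least `(1 / 8 - q v) / m`, where
`q v` is the probability that `v` is eliminated by time `t + Tdiff`
(`exists_le_measureReal_wins`). For a fixed `u` these events are disjoint.

**Counting.** Summing `d u` times the resulting lower bound for `q u` over all `u`, the two
directions of an edge contribute `1 / (8 * K)` in total, and the correction terms are at most the
left-hand side divided by `K` (`mul_card_edgeFinset_le`). So the sum of `d u * q u` is at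
least the number of active edges divided by `8 * (K + 1)`, and the expected number of lost edges is
at least half of it (`setIntegral_numActive_le`). As `Tdiff / Tmin ≥ 3`, this gives the constant
`28`.

**Convergence.** Iterating the bound from time `0` and applying Markov's inequality, no edge is
active after logarithmically many periods with high probability. Then an agent that is not
eliminated has no competitors and joins in its next decisive round
(`convergedBy_of_activeEdges_eq_empty`).
-/

namespace Singing

/-! ### Rounds and hearing -/

/-- The assumptions on the time parameters: rounds have a positive minimal length, and a delay is at
most half of it. -/
structure Admissible (Tmin Δmax : ℝ) : Prop where
  Tmin_pos : 0 < Tmin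
  delay_nonneg : 0 ≤ Δmax
  two_delay_le : 2 * Δmax ≤ Tmin

theorem zero_mem_notes {s : AgentState} {l : ℕ} : 0 ∈ notes s l ↔ s = .isIn := by
  cases s <;> simp [notes]

theorem mem_notes_of_pos {s : AgentState} {l k : ℕ} (hk : 0 < k) :
    k ∈ notes s l ↔ s = .un ∧ k ≤ l := by
  cases s <;> simp [notes] <;> omega

theorem ell_pos {V : Type*} (ω : Coins V) (v : V) (j : ℕ) : 0 < ell ω v j := Nat.succ_pos _

namespace Execution

variable {V : Type*} {G : SimpleGraph V} {Tmin Tmax Δmax : ℝ} (X : Execution G Tmin Tmax Δmax)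

theorem start_add_le (v : V) (j : ℕ) (ω : Coins V) :
    X.start v j ω + Tmin ≤ X.start v (j + 1) ω := by
  have := (X.duration_mem v j ω).1
  linarith

theorem start_le_add (v : V) (j : ℕ) (ω : Coins V) :
    X.start v (j + 1) ω ≤ X.start v j ω + Tmax := by
  have := (X.duration_mem v j ω).2
  linarith

theorem Tmin_le_Tmax (X : Execution G Tmin Tmax Δmax) (v : V) : Tmin ≤ Tmax := by
  have := X.duration_mem v 0 (fun _ => false)
  exact this.1.trans this.2

theorem start_strictMono (h : Admissible Tmin Δmax) (v : V) (ω : Coins V) :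
    StrictMono (fun j => X.start v j ω) :=
  strictMono_nat_of_lt_succ fun j => by
    have := X.start_add_le v j ω
    have := h.Tmin_pos
    linarith

theorem start_lt_iff (h : Admissible Tmin Δmax) {v : V} {i j : ℕ} {ω : Coins V} :
    X.start v i ω < X.start v j ω ↔ i < j :=
  (X.start_strictMono h v ω).lt_iff_lt

theorem start_le_iff (h : Admissible Tmin Δmax) {v : V} {i j : ℕ} {ω : Coins V} :
    X.start v i ω ≤ X.start v j ω ↔ i ≤ j :=
  (X.start_strictMono h v ω).le_iff_le

theorem start_add_mul_le (v : V) (j k : ℕ) (ω : Coins V) :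
    X.start v j ω + k * Tmin ≤ X.start v (j + k) ω := by
  induction k with
  | zero => simp
  | succ k ih =>
    have := X.start_add_le v (j + k) ω
    rw [← add_assoc]
    push_cast
    linarith

theorem start_zero_nonpos (v : V) (ω : Coins V) : X.start v 0 ω ≤ 0 := by
  obtain ⟨a, ha, h⟩ := X.start_zero v
  rw [h]; exact ha

theorem start_zero_eq (v : V) (ω ω' : Coins V) : X.start v 0 ω = X.start v 0 ω' := by
  obtain ⟨a, ha, h⟩ := X.start_zero v
  rw [h, h]

theorem exists_start_gt (h : Admissible Tmin Δmax) (v : V) (ω : Coins V) (τ : ℝ) :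
    ∃ j, τ < X.start v j ω := by
  obtain ⟨k, hk⟩ := exists_nat_gt ((τ - X.start v 0 ω) / Tmin)
  rw [div_lt_iff₀ h.Tmin_pos] at hk
  have := X.start_add_mul_le v 0 k ω
  exact ⟨0 + k, by linarith⟩

theorem exists_first_start_ge (h : Admissible Tmin Δmax) (v : V) (ω : Coins V) {s : ℝ}
    (hs : 0 < s) : ∃ r, X.start v r ω < s ∧ s ≤ X.start v (r + 1) ω := by
  classical
  have hex : ∃ j, s ≤ X.start v j ω := by
    obtain ⟨j, hj⟩ := X.exists_start_gt h v ω s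
    exact ⟨j, hj.le⟩
  have h0 : Nat.find hex ≠ 0 := by
    intro h0
    have := Nat.find_spec hex
    rw [h0] at this
    have := X.start_zero_nonpos v ω
    linarith
  obtain ⟨r, hr⟩ := Nat.exists_eq_succ_of_ne_zero h0
  refine ⟨r, ?_, ?_⟩
  · have := Nat.find_min hex (m := r) (by omega)
    exact not_le.mp this
  · have := Nat.find_spec hex
    rwa [hr] at this

theorem exists_inRound (h : Admissible Tmin Δmax) (v : V) (ω : Coins V) {τ : ℝ}
    (hτ : X.start v 0 ω ≤ τ) : ∃ j, InRound (X.start · · ω) v j τ := by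
  classical
  have hex := X.exists_start_gt h v ω τ
  have h0 : Nat.find hex ≠ 0 := by
    intro h0
    have := Nat.find_spec hex
    rw [h0] at this
    linarith
  obtain ⟨r, hr⟩ := Nat.exists_eq_succ_of_ne_zero h0
  refine ⟨r, ?_, ?_⟩
  · have := Nat.find_min hex (m := r) (by omega)
    exact not_lt.mp this
  · have := Nat.find_spec hex
    rwa [hr] at this

/-- Of two rounds of an agent, the one in progress at time `τ` has index at least that of a round
started by then. -/
theorem le_of_inRound (h : Admissible Tmin Δmax) {v : V} {ω : Coins V} {i j : ℕ} {τ : ℝ}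
    (hj : InRound (X.start · · ω) v j τ) (hi : X.start v i ω ≤ τ) : i ≤ j := by
  have := (X.start_lt_iff h).1 (lt_of_le_of_lt hi hj.2)
  omega

/-- The notes of round `i` of `u` are heard in round `j` of `v` whenever round `i` starts at least
`Δmax` before the end of round `j`, and round `j` starts before the end of round `i`. -/
theorem hears_of_overlap (h : Admissible Tmin Δmax) {u v : V} (huv : G.Adj u v) {i j k : ℕ}
    {ω : Coins V} (h1 : X.start u i ω + Δmax ≤ X.start v (j + 1) ω)
    (h1' : X.start u i ω < X.start v (j + 1) ω)
    (h2 : X.start v j ω < X.start u (i + 1) ω)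
    (hk : k ∈ notes (X.state u i ω) (ell ω u i)) :
    Hears G X.delay (X.start · · ω) (X.state · · ω) (ell ω) v j k := by
  have hd := X.delay_mem u v (max (X.start u i ω) (X.start v j ω)) huv
  have hT := h.Tmin_pos
  have h2D := h.two_delay_le
  have hD := h.delay_nonneg
  have hv := X.start_add_le v j ω
  have hu := X.start_add_le u i ω
  refine ⟨u, huv, max (X.start u i ω) (X.start v j ω), ?_, ⟨?_, ?_⟩, i, ⟨?_, ?_⟩, hk⟩
  · exact max_lt h1' (by linarith)
  · have := le_max_right (X.start u i ω) (X.start v j ω)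
    have := hd.1
    linarith
  · have : max (X.start u i ω) (X.start v j ω) ≤ X.start v (j + 1) ω - Δmax :=
      max_le (by linarith) (by linarith)
    have := hd.2
    linarith
  · exact le_max_left _ _
  · exact max_lt (by linarith) h2

/-- What is heard in round `j` of `v` was sung by a neighbour in a round that was in progress at a
time between `Δmax` before the start of round `j` and the end of round `j`. -/
theorem exists_of_hears {v : V} {j k : ℕ} {ω : Coins V}
    (hh : Hears G X.delay (X.start · · ω) (X.state · · ω) (ell ω) v j k) :
    ∃ u, G.Adj u v ∧ ∃ i τ, X.start v j ω - Δmax ≤ τ ∧ τ < X.start v (j + 1) ω ∧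
      InRound (X.start · · ω) u i τ ∧ k ∈ notes (X.state u i ω) (ell ω u i) := by
  obtain ⟨u, huv, τ, hτ, hmem, i, hi, hk⟩ := hh
  refine ⟨u, huv, i, τ, ?_, hτ, hi, hk⟩
  have := (X.delay_mem u v τ huv).2
  have := hmem.1
  linarith

/-- Agent `v` hears note `k` in its round `j`. -/
abbrev HearsAt (ω : Coins V) (v : V) (j k : ℕ) : Prop :=
  Hears G X.delay (X.start · · ω) (X.state · · ω) (ell ω) v j k

theorem isIn_succ_iff (ω : Coins V) (v : V) (j : ℕ) :
    X.state v (j + 1) ω = .isIn ↔ ¬ X.HearsAt ω v j 0 ∧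
      (X.state v j ω = .isIn ∨ X.state v j ω = .un ∧ ¬ X.HearsAt ω v j (ell ω v j)) := by
  rw [X.state_succ v j ω]
  cases X.state v j ω <;> simp only [nextState] <;> split_ifs <;> simp_all

theorem out_succ_iff (ω : Coins V) (v : V) (j : ℕ) :
    X.state v (j + 1) ω = .out ↔ X.HearsAt ω v j 0 ∧ X.state v j ω ≠ .isIn := by
  rw [X.state_succ v j ω]
  cases X.state v j ω <;> simp only [nextState] <;> split_ifs <;> simp_all

/-! ### Induction along the order of start times -/

theorem finite_start_lt [Finite V] (h : Admissible Tmin Δmax) (ω : Coins V) (T : ℝ) :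
    {p : V × ℕ | X.start p.1 p.2 ω < T}.Finite := by
  choose N hN using fun v => X.exists_start_gt h v ω T
  refine Set.Finite.subset (s := ⋃ v, (fun i => (v, i)) '' Set.Iio (N v))
    (Set.finite_iUnion fun v => (Set.finite_Iio _).image _) ?_
  rintro ⟨v, i⟩ hi
  simp only [Set.mem_iUnion, Set.mem_image, Set.mem_Iio]
  exact ⟨v, i, (X.start_lt_iff h).1 (lt_trans hi (hN v)), rfl⟩

/-- Strong induction on the start times of rounds. -/
theorem start_induction [Finite V] (h : Admissible Tmin Δmax) (ω : Coins V)
    {P : V → ℕ → Prop}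
    (step : ∀ v j, (∀ u i, X.start u i ω < X.start v j ω → P u i) → P v j) (v : V) (j : ℕ) :
    P v j := by
  have key : ∀ n : ℕ, ∀ v j,
      {p : V × ℕ | X.start p.1 p.2 ω < X.start v j ω}.ncard = n → P v j := by
    intro n
    induction n using Nat.strong_induction_on with
    | _ n ih =>
      intro v j hn
      refine step v j fun u i hui => ih _ ?_ u i rfl
      rw [← hn]
      refine Set.ncard_lt_ncard ?_ (X.finite_start_lt h ω _)
      refine ⟨fun p hp => lt_trans hp hui, fun hsub => ?_⟩
      have : (u, i) ∈ {p : V × ℕ | X.start p.1 p.2 ω < X.start u i ω} := hsub hui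
      exact lt_irrefl (X.start u i ω) this
  exact key _ v j rfl

/-! ### Adjacent agents are never both in state In -/

/-- While no two adjacent agents are in state In in rounds starting before `T`, an agent in state In
stays in it. -/
theorem isIn_mono_of_lt (h : Admissible Tmin Δmax) (ω : Coins V) {T : ℝ}
    (hT : ∀ u v i j, G.Adj u v → X.start u i ω < T → X.start v j ω < T →
      X.state u i ω = .isIn → X.state v j ω = .isIn → False)
    {v : V} {i j : ℕ} (hij : i ≤ j) (hj : X.start v j ω ≤ T) (hi : X.state v i ω = .isIn) :
    X.state v j ω = .isIn := by
  induction j, hij using Nat.le_induction with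
  | base => exact hi
  | succ j hij ih =>
    have hjlt : X.start v j ω < T := lt_of_lt_of_le ((X.start_lt_iff h).2 j.lt_succ_self) hj
    have hin := ih hjlt.le
    rw [isIn_succ_iff]
    refine ⟨fun hh => ?_, Or.inl hin⟩
    obtain ⟨w, hw, k, τ, -, hτ, hk, hmem⟩ := X.exists_of_hears hh
    rw [zero_mem_notes] at hmem
    exact hT w v k j hw (lt_of_le_of_lt hk.1 (lt_of_lt_of_le hτ hj)) hjlt hmem hin

theorem exists_turn_isIn {ω : Coins V} {v : V} {j : ℕ} (hj : X.state v j ω = .isIn) :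
    ∃ i < j, X.state v i ω = .un ∧ X.state v (i + 1) ω = .isIn := by
  induction j with
  | zero => rw [X.state_zero] at hj; cases hj
  | succ j ih =>
    rcases ((X.isIn_succ_iff ω v j).1 hj).2 with h1 | h1
    · obtain ⟨i, hi, hh⟩ := ih h1
      exact ⟨i, by omega, hh⟩
    · exact ⟨j, by omega, h1.1, hj⟩

/-- Two adjacent agents do not turn In less than `Δmax` apart: the last round of each in state Un
would have been heard by the other, so each would need a larger `ℓ`-value than the other. -/
theorem not_turn_isIn_close (h : Admissible Tmin Δmax) {ω : Coins V} {u v : V} (huv : G.Adj u v)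
    {i j : ℕ} (hu : X.state u i ω = .un) (hu' : X.state u (i + 1) ω = .isIn)
    (hv : X.state v j ω = .un) (hv' : X.state v (j + 1) ω = .isIn)
    (hle : X.start u (i + 1) ω ≤ X.start v (j + 1) ω)
    (hclose : X.start v (j + 1) ω < X.start u (i + 1) ω + Δmax ∨
      X.start v (j + 1) ω = X.start u (i + 1) ω) : False := by
  have hT := h.Tmin_pos
  have h2D := h.two_delay_le
  have hD := h.delay_nonneg
  have h1 := X.start_add_le v j ω
  have h2 := X.start_add_le u i ω
  have hclose' : X.start v (j + 1) ω ≤ X.start u (i + 1) ω + Δmax := by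
    rcases hclose with hc | hc <;> linarith
  have hu1 : ¬ X.HearsAt ω u i (ell ω u i) := by
    have := ((X.isIn_succ_iff ω u i).1 hu').2
    simpa [hu] using this
  have hv1 : ¬ X.HearsAt ω v j (ell ω v j) := by
    have := ((X.isIn_succ_iff ω v j).1 hv').2
    simpa [hv] using this
  have hlt1 : ell ω v j < ell ω u i := by
    by_contra hcon
    refine hu1 (X.hears_of_overlap h huv.symm (i := j) (by linarith) (by linarith) (by linarith) ?_)
    rw [mem_notes_of_pos (ell_pos ω u i)]
    exact ⟨hv, not_lt.1 hcon⟩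
  refine hv1 (X.hears_of_overlap h huv (i := i) (by linarith) (by linarith) (by linarith) ?_)
  rw [mem_notes_of_pos (ell_pos ω v j)]
  exact ⟨hu, hlt1.le⟩

/-- Two adjacent agents do not both turn In, if no adjacent agents are both in state In before: if
the second one is late enough to escape `not_turn_isIn_close`, it hears note `0` from the first. -/
theorem not_turn_isIn (h : Admissible Tmin Δmax) {ω : Coins V} {u v : V} (huv : G.Adj u v)
    {i j : ℕ} (hu : X.state u i ω = .un) (hu' : X.state u (i + 1) ω = .isIn)
    (hv : X.state v j ω = .un) (hv' : X.state v (j + 1) ω = .isIn)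
    (hle : X.start u (i + 1) ω ≤ X.start v (j + 1) ω)
    (hT : ∀ u' v' i' j', G.Adj u' v' → X.start u' i' ω < X.start v (j + 1) ω →
      X.start v' j' ω < X.start v (j + 1) ω →
      X.state u' i' ω = .isIn → X.state v' j' ω = .isIn → False) : False := by
  by_cases hclose : X.start v (j + 1) ω < X.start u (i + 1) ω + Δmax ∨
      X.start v (j + 1) ω = X.start u (i + 1) ω
  · exact X.not_turn_isIn_close h huv hu hu' hv hv' hle hclose
  · obtain ⟨hc1, hc2⟩ := not_or.1 hclose
    have hT' := h.Tmin_pos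
    have h2D := h.two_delay_le
    have hD := h.delay_nonneg
    have hv1 := X.start_add_le v j ω
    have hlt : X.start u (i + 1) ω < X.start v (j + 1) ω := lt_of_le_of_ne hle (Ne.symm hc2)
    -- `u` sings note `0` from its round `i + 1` on, and `v` hears it in its round `j`
    obtain ⟨k, hk⟩ := X.exists_inRound h u ω (τ := max (X.start u (i + 1) ω) (X.start v j ω))
      (((X.start_le_iff h).2 (Nat.zero_le _)).trans (le_max_left _ _))
    have hik := X.le_of_inRound h hk (le_max_left _ _)
    have hkle : X.start u k ω ≤ X.start v (j + 1) ω - Δmax :=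
      hk.1.trans (max_le (by linarith) (by linarith))
    have hklt : X.start u k ω < X.start v (j + 1) ω :=
      hk.1.trans_lt (max_lt hlt (by linarith))
    refine ((X.isIn_succ_iff ω v j).1 hv').1 (X.hears_of_overlap h huv (i := k) (by linarith) hklt
      ((le_max_right _ _).trans_lt hk.2) ?_)
    rw [zero_mem_notes]
    exact X.isIn_mono_of_lt h ω hT hik hklt.le hu'

/-- **Safety.** Adjacent agents are never both in state In, not even at different times. -/
theorem not_both_isIn [Finite V] (h : Admissible Tmin Δmax) {ω : Coins V} {u v : V}
    (huv : G.Adj u v) {i j : ℕ} (hu : X.state u i ω = .isIn) (hv : X.state v j ω = .isIn) :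
    False := by
  have key : ∀ v j, ∀ u i, G.Adj u v → X.start u i ω ≤ X.start v j ω →
      X.state u i ω = .isIn → X.state v j ω = .isIn → False := by
    refine X.start_induction h ω ?_
    intro v j ih u i huv hle hu hv
    have hT : ∀ u' v' i' j', G.Adj u' v' → X.start u' i' ω < X.start v j ω →
        X.start v' j' ω < X.start v j ω →
        X.state u' i' ω = .isIn → X.state v' j' ω = .isIn → False := by
      intro u' v' i' j' hadj hlt1 hlt2 hin1 hin2
      rcases le_total (X.start u' i' ω) (X.start v' j' ω) with hl | hl
      · exact ih v' j' hlt2 u' i' hadj hl hin1 hin2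
      · exact ih u' i' hlt1 v' j' hadj.symm hl hin2 hin1
    obtain ⟨i₀, hi₀, hui, hui'⟩ := X.exists_turn_isIn hu
    obtain ⟨j₀, hj₀, hvj, hvj'⟩ := X.exists_turn_isIn hv
    have hi_le : X.start u (i₀ + 1) ω ≤ X.start v j ω := ((X.start_le_iff h).2 hi₀).trans hle
    have hj_le : X.start v (j₀ + 1) ω ≤ X.start v j ω := (X.start_le_iff h).2 hj₀
    rcases le_total (X.start u (i₀ + 1) ω) (X.start v (j₀ + 1) ω) with hl | hl
    · exact X.not_turn_isIn h huv hui hui' hvj hvj' hl fun u' v' i' j' hadj h1 h2 =>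
        hT u' v' i' j' hadj (h1.trans_le hj_le) (h2.trans_le hj_le)
    · exact X.not_turn_isIn h huv.symm hvj hvj' hui hui' hl fun u' v' i' j' hadj h1 h2 =>
        hT u' v' i' j' hadj (h1.trans_le hi_le) (h2.trans_le hi_le)
  rcases le_total (X.start u i ω) (X.start v j ω) with hl | hl
  · exact key v j u i huv hl hu hv
  · exact key u i v j huv.symm hl hv hu

end Execution
end Singing

namespace Singing
namespace Execution

variable {V : Type*} {G : SimpleGraph V} {Tmin Tmax Δmax : ℝ} (X : Execution G Tmin Tmax Δmax)

/-! ### Elimination is permanent -/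

theorem isIn_mono [Finite V] (h : Admissible Tmin Δmax) {ω : Coins V} {v : V} {i j : ℕ}
    (hij : i ≤ j) (hi : X.state v i ω = .isIn) : X.state v j ω = .isIn :=
  X.isIn_mono_of_lt h ω (fun _ _ _ _ hadj _ _ => X.not_both_isIn h hadj) hij le_rfl hi

/-- Agent `v` has been in state In at some time up to `t`. -/
def InBy (t : ℝ) (ω : Coins V) (v : V) : Prop :=
  ∃ j, X.start v j ω ≤ t ∧ X.state v j ω = .isIn

/-- Agent `v` or one of its neighbours has been in state In at some time up to `t`. As state In is
never left, this is elimination at time `t`; see `eliminated_iff`. -/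
def ElimBy (t : ℝ) (ω : Coins V) (v : V) : Prop :=
  X.InBy t ω v ∨ ∃ u, G.Adj v u ∧ X.InBy t ω u

theorem InBy.mono {X : Execution G Tmin Tmax Δmax} {t t' : ℝ} (htt' : t ≤ t') {ω : Coins V} {v : V}
    (hv : X.InBy t ω v) : X.InBy t' ω v :=
  let ⟨j, hj, hs⟩ := hv
  ⟨j, hj.trans htt', hs⟩

theorem ElimBy.mono {X : Execution G Tmin Tmax Δmax} {t t' : ℝ} (htt' : t ≤ t') {ω : Coins V}
    {v : V} (hv : X.ElimBy t ω v) : X.ElimBy t' ω v :=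
  hv.imp (InBy.mono htt') fun ⟨u, hu, hin⟩ => ⟨u, hu, hin.mono htt'⟩

theorem stateAt_isIn_iff [Finite V] (h : Admissible Tmin Δmax) {t : ℝ} (ht : 0 ≤ t) {ω : Coins V}
    {v : V} : X.StateAt t ω v .isIn ↔ X.InBy t ω v := by
  constructor
  · rintro ⟨j, hj, hs⟩
    exact ⟨j, hj.1, hs⟩
  · rintro ⟨i, hi, hs⟩
    obtain ⟨j, hj⟩ := X.exists_inRound h v ω ((X.start_zero_nonpos v ω).trans ht)
    exact ⟨j, hj, X.isIn_mono h (X.le_of_inRound h hj hi) hs⟩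

theorem not_inBy_of_adj [Finite V] (h : Admissible Tmin Δmax) {t t' : ℝ} {ω : Coins V} {u v : V}
    (huv : G.Adj u v) (hu : X.InBy t ω u) : ¬ X.InBy t' ω v := by
  rintro ⟨j, -, hj⟩
  obtain ⟨i, -, hi⟩ := hu
  exact X.not_both_isIn h huv hi hj

theorem eliminated_iff [Finite V] (h : Admissible Tmin Δmax) {t : ℝ} (ht : 0 ≤ t) {ω : Coins V}
    {v : V} : X.Eliminated t ω v ↔ X.ElimBy t ω v := by
  have key : ∀ w, X.InUnconflicted t ω w ↔ X.InBy t ω w := fun w => by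
    unfold InUnconflicted
    simp only [X.stateAt_isIn_iff h ht]
    exact and_iff_left_of_imp fun hw u hwu => X.not_inBy_of_adj h hwu hw
  simp only [Eliminated, ElimBy, key]

theorem elimBy_of_out {ω : Coins V} {v : V} {j : ℕ} (hj : X.state v j ω = .out) :
    X.ElimBy (X.start v j ω) ω v := by
  cases j with
  | zero => rw [X.state_zero] at hj; cases hj
  | succ j =>
    obtain ⟨u, huv, i, τ, -, hτ, hi, hmem⟩ := X.exists_of_hears ((X.out_succ_iff ω v j).1 hj).1
    rw [zero_mem_notes] at hmem
    exact Or.inr ⟨u, huv.symm, i, hi.1.trans hτ.le, hmem⟩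

/-- Only undecided agents are not eliminated. -/
theorem un_of_not_elimBy {t : ℝ} {ω : Coins V} {v : V} {j : ℕ} (hv : ¬ X.ElimBy t ω v)
    (hj : X.start v j ω ≤ t) : X.state v j ω = .un := by
  cases hs : X.state v j ω with
  | out => exact absurd ((X.elimBy_of_out hs).mono hj) hv
  | isIn => exact absurd (Or.inl ⟨j, hj, hs⟩) hv
  | un => rfl

/-- The neighbours of an agent in state In at time `t` are in state Out in all rounds that start
later than `t + Δmax`. -/
theorem out_of_inBy_adj [Finite V] (h : Admissible Tmin Δmax) {t : ℝ} (ht : 0 ≤ t) {ω : Coins V}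
    {u v : V} (huv : G.Adj u v) (hu : X.InBy t ω u) {j : ℕ} (hj : t + Δmax < X.start v j ω) :
    X.state v j ω = .out := by
  have hD := h.delay_nonneg
  have h2D := h.two_delay_le
  have hT := h.Tmin_pos
  cases j with
  | zero =>
    have := X.start_zero_nonpos v ω
    linarith
  | succ j =>
    obtain ⟨i, hi, hs⟩ := hu
    obtain ⟨k, hk⟩ := X.exists_inRound h u ω (τ := max (X.start u i ω) (X.start v j ω))
      (((X.start_le_iff h).2 (Nat.zero_le _)).trans (le_max_left _ _))
    have hik := X.le_of_inRound h hk (le_max_left _ _)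
    have hv := X.start_add_le v j ω
    have hkle : X.start u k ω ≤ X.start v (j + 1) ω - Δmax :=
      hk.1.trans (max_le (by linarith) (by linarith))
    have hklt : X.start u k ω < X.start v (j + 1) ω :=
      hk.1.trans_lt (max_lt (by linarith) (by linarith))
    rw [out_succ_iff]
    refine ⟨X.hears_of_overlap h huv (i := k) (by linarith) hklt
      ((le_max_right _ _).trans_lt hk.2) (zero_mem_notes.2 (X.isIn_mono h hik hs)), fun hvin => ?_⟩
    exact X.not_both_isIn h huv hs hvin

/-! ### How an agent joins the independent set -/

/-- Let `v` start round `r` at a time in `[s, s + Tmax)`, where `s = t + 2 * Δmax + Tmax`, and not be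
eliminated up to `Δmax` later. By then the neighbours eliminated at time `t` have been silent for so
long that `v` hears only neighbours that were not eliminated at time `t`, in rounds that started
after `t`. If its `ℓ`-value beats those of all these rounds, then `v` joins: it hears nothing that
keeps it out, and a neighbour that turned In more than `Δmax` after the start of round `r` would
have heard `v` before. -/
theorem isIn_succ_of_wins [Finite V] (h : Admissible Tmin Δmax) {t : ℝ} (ht : 0 ≤ t) {ω : Coins V}
    {v : V} {r : ℕ} (hs : t + 2 * Δmax + Tmax ≤ X.start v r ω)
    (hs' : X.start v r ω < t + 2 * Δmax + 2 * Tmax)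
    (hv : ¬ X.ElimBy (X.start v r ω + Δmax) ω v)
    (hwin : ∀ x, G.Adj v x → ¬ X.ElimBy t ω x → ∀ i, t < X.start x i ω →
      X.start x i ω < t + 2 * Δmax + 3 * Tmax → ell ω x i < ell ω v r) :
    X.state v (r + 1) ω = .isIn := by
  have hD := h.delay_nonneg
  have h2D := h.two_delay_le
  have hT := h.Tmin_pos
  have hTT := X.Tmin_le_Tmax v
  have hdur := X.start_le_add v r ω
  have hdur' := X.start_add_le v r ω
  have hun : X.state v r ω = .un := X.un_of_not_elimBy hv (by linarith)
  have hnotIn : ∀ x, G.Adj v x → ¬ X.InBy t ω x := fun x hx hin =>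
    hv (Or.inr ⟨x, hx, hin.mono (by linarith)⟩)
  rw [isIn_succ_iff]
  refine ⟨fun h0 => ?_, Or.inr ⟨hun, fun hown => ?_⟩⟩
  · obtain ⟨x, hx, i, τ, -, hτ, hi, hmem⟩ := X.exists_of_hears h0
    rw [zero_mem_notes] at hmem
    obtain ⟨i', hi'i, hxun, hxin⟩ := X.exists_turn_isIn hmem
    have hle : X.start x (i' + 1) ω ≤ X.start x i ω := (X.start_le_iff h).2 hi'i
    have hlt : X.start v r ω + Δmax < X.start x (i' + 1) ω := by
      by_contra hcon
      exact hv (Or.inr ⟨x, hx.symm, i' + 1, not_lt.1 hcon, hxin⟩)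
    have hi1 := hi.1
    have hx1 := X.start_le_add x i' ω
    have hx2 := X.start_add_le x i' ω
    have hnot : ¬ X.HearsAt ω x i' (ell ω x i') := by
      have := ((X.isIn_succ_iff ω x i').1 hxin).2
      simpa [hxun] using this
    have hell : ell ω v r < ell ω x i' := by
      by_contra hcon
      refine hnot (X.hears_of_overlap h hx.symm (i := r) hlt.le (by linarith) (by linarith) ?_)
      rw [mem_notes_of_pos (ell_pos ω x i')]
      exact ⟨hun, not_lt.1 hcon⟩
    refine lt_asymm hell (hwin x hx.symm ?_ i' (by linarith) (by linarith))
    rintro (hin | ⟨y, hxy, hy⟩)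
    · exact hnotIn x hx.symm hin
    · exact X.not_inBy_of_adj h hxy.symm hy ⟨_, le_rfl, hxin⟩
  · obtain ⟨x, hx, i, τ, hτ1, hτ2, hi, hmem⟩ := X.exists_of_hears hown
    rw [mem_notes_of_pos (ell_pos ω v r)] at hmem
    have hi1 := hi.1
    have hi2 := hi.2
    have hx1 := X.start_le_add x i ω
    refine absurd hmem.2 (not_le.2 (hwin x hx.symm ?_ i (by linarith) (by linarith)))
    rintro (hin | ⟨y, hxy, hy⟩)
    · exact hnotIn x hx.symm hin
    · have := X.out_of_inBy_adj h ht hxy.symm hy (j := i) (by linarith)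
      rw [hmem.1] at this
      cases this

/-! ### Convergence once no edge is active -/

theorem mem_activeEdges_iff [Finite V] (h : Admissible Tmin Δmax) {t : ℝ} (ht : 0 ≤ t)
    {ω : Coins V} {u v : V} :
    s(u, v) ∈ X.activeEdges t ω ↔ G.Adj u v ∧ ¬ X.ElimBy t ω u ∧ ¬ X.ElimBy t ω v := by
  simp [activeEdges, X.eliminated_iff h ht]

theorem elimBy_of_activeEdges_eq_empty [Finite V] (h : Admissible Tmin Δmax) {t : ℝ} (ht : 0 ≤ t)
    {ω : Coins V} (hE : X.activeEdges t ω = ∅) (v : V) :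
    X.ElimBy (t + 2 * Δmax + 3 * Tmax) ω v := by
  have hD := h.delay_nonneg
  have h2D := h.two_delay_le
  have hT := h.Tmin_pos
  have hTT := X.Tmin_le_Tmax v
  by_cases hv : X.ElimBy t ω v
  · exact hv.mono (by linarith)
  obtain ⟨r, hr1, hr2⟩ := X.exists_first_start_ge h v ω (s := t + 2 * Δmax + Tmax) (by linarith)
  have h1 := X.start_le_add v r ω
  have h2 := X.start_le_add v (r + 1) ω
  by_cases hel : X.ElimBy (X.start v (r + 1) ω + Δmax) ω v
  · exact hel.mono (by linarith)
  · refine Or.inl ⟨r + 1 + 1, by linarith, ?_⟩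
    refine X.isIn_succ_of_wins h ht hr2 (by linarith) hel fun x hx hxe => ?_
    have : s(v, x) ∈ X.activeEdges t ω := (X.mem_activeEdges_iff h ht).2 ⟨hx, hv, hxe⟩
    rw [hE] at this
    exact this.elim

theorem convergedBy_of_forall_elimBy [Finite V] (h : Admissible Tmin Δmax) {t t' : ℝ} (ht : 0 ≤ t)
    {ω : Coins V} (hel : ∀ v, X.ElimBy t ω v) (htt' : t + Δmax + Tmax ≤ t') :
    X.ConvergedBy t' ω := by
  have hD := h.delay_nonneg
  have hT := h.Tmin_pos
  refine ⟨{v | X.InBy t ω v}, ⟨fun u hu v hv _ huv => X.not_inBy_of_adj h huv hu hv, ?_⟩, ?_⟩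
  · intro I hI hsub v hv
    rcases hel v with hin | ⟨u, hvu, hin⟩
    · exact hin
    · exact absurd hvu (hI hv (hsub hin) hvu.ne)
  · intro t'' ht'' v
    have hTT := X.Tmin_le_Tmax v
    have hle : t ≤ t'' := by linarith [ht''.le]
    refine ⟨fun hv => (X.stateAt_isIn_iff h (ht.trans hle)).2 (InBy.mono hle hv), fun hv => ?_⟩
    rcases hel v with hin | ⟨u, hvu, hin⟩
    · exact absurd hin hv
    · obtain ⟨j, hj⟩ := X.exists_inRound h v ω ((X.start_zero_nonpos v ω).trans (ht.trans hle))
      have h1 := X.start_le_add v j ω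
      have h2 := hj.2
      exact ⟨j, hj, X.out_of_inBy_adj h ht hvu.symm hin (by linarith [ht''.le])⟩

/-- Once no edge is active, the protocol converges within time `3 * Δmax + 4 * Tmax`. -/
theorem convergedBy_of_activeEdges_eq_empty [Finite V] (h : Admissible Tmin Δmax) {t t' : ℝ}
    (ht : 0 ≤ t) {ω : Coins V} (hE : X.activeEdges t ω = ∅)
    (htt' : t + 3 * Δmax + 4 * Tmax ≤ t') (hTmax : 0 ≤ Tmax) : X.ConvergedBy t' ω := by
  have hD := h.delay_nonneg
  exact X.convergedBy_of_forall_elimBy h (t := t + 2 * Δmax + 3 * Tmax) (by linarith)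
    (X.elimBy_of_activeEdges_eq_empty h ht hE) (by linarith)

end Execution
end Singing

namespace Singing
namespace Execution

variable {V : Type*} {G : SimpleGraph V} {Tmin Tmax Δmax : ℝ} (X : Execution G Tmin Tmax Δmax)

/-! ### What the execution depends on -/

/-- The outcomes `ω` and `ω'` give the same `ℓ`-values to all rounds that start before time `T`
in the outcome `ω`. -/
def AgreeBefore (T : ℝ) (ω ω' : Coins V) : Prop :=
  ∀ v j, X.start v j ω < T → ell ω v j = ell ω' v j

/-- Start times are determined by earlier `ℓ`-values. Even the end of a round that starts at time `T`
is, as the durations are fixed before the rounds begin. -/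
theorem AgreeBefore.start_eq_and [Finite V] {X : Execution G Tmin Tmax Δmax}
    (h : Admissible Tmin Δmax) {T : ℝ} {ω ω' : Coins V} (hag : X.AgreeBefore T ω ω')
    (v : V) (j : ℕ) (hj : X.start v j ω ≤ T) :
    X.start v j ω' = X.start v j ω ∧ X.start v (j + 1) ω' = X.start v (j + 1) ω := by
  revert hj
  refine X.start_induction h ω (P := fun v j => X.start v j ω ≤ T →
    X.start v j ω' = X.start v j ω ∧ X.start v (j + 1) ω' = X.start v (j + 1) ω) ?_ v j
  intro v j ih hj
  have heq : X.start v j ω' = X.start v j ω := by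
    cases j with
    | zero => exact X.start_zero_eq v ω' ω
    | succ j =>
      have hlt : X.start v j ω < X.start v (j + 1) ω := (X.start_lt_iff h).2 j.lt_succ_self
      exact (ih v j hlt (hlt.le.trans hj)).2
  refine ⟨heq, X.nonanticipating v j ω' ω heq ?_⟩
  have h1 : ∀ u i, X.start u i ω < X.start v j ω → X.start u i ω' = X.start u i ω :=
    fun u i hi => (ih u i hi (hi.le.trans hj)).1
  have h2 : ∀ u i, X.start u i ω' < X.start v j ω → X.start u i ω < X.start v j ω := by
    intro u i
    induction i with
    | zero => rw [X.start_zero_eq u ω' ω]; exact id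
    | succ i ihi =>
      intro hi
      have hlt : X.start u i ω' < X.start u (i + 1) ω' := (X.start_lt_iff h).2 i.lt_succ_self
      have hi' := ihi (hlt.trans hi)
      rwa [(ih u i hi' (hi'.le.trans hj)).2] at hi
  funext u i
  unfold historyBefore
  rw [heq]
  by_cases hc : X.start u i ω < X.start v j ω
  · rw [if_pos hc, if_pos (by rwa [h1 u i hc]), h1 u i hc, hag u i (hc.trans_le hj)]
  · rw [if_neg hc, if_neg fun hc' => hc (h2 u i hc')]

theorem AgreeBefore.start_eq [Finite V] {X : Execution G Tmin Tmax Δmax}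
    (h : Admissible Tmin Δmax) {T : ℝ} {ω ω' : Coins V} (hag : X.AgreeBefore T ω ω')
    {v : V} {j : ℕ} (hj : X.start v j ω ≤ T + Tmin) : X.start v j ω' = X.start v j ω := by
  cases j with
  | zero => exact X.start_zero_eq v ω' ω
  | succ j =>
    have := X.start_add_le v j ω
    exact (hag.start_eq_and h v j (by linarith)).2

theorem AgreeBefore.start_eq' [Finite V] {X : Execution G Tmin Tmax Δmax}
    (h : Admissible Tmin Δmax) {T : ℝ} {ω ω' : Coins V} (hag : X.AgreeBefore T ω ω')
    {v : V} {j : ℕ} (hj : X.start v j ω' ≤ T + Tmin) : X.start v j ω' = X.start v j ω := by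
  induction j with
  | zero => exact X.start_zero_eq v ω' ω
  | succ j ih =>
    have h1 := X.start_add_le v j ω'
    have hT := h.Tmin_pos
    exact (hag.start_eq_and h v j (by rw [← ih (by linarith)]; linarith)).2

theorem AgreeBefore.symm [Finite V] {X : Execution G Tmin Tmax Δmax}
    (h : Admissible Tmin Δmax) {T : ℝ} {ω ω' : Coins V} (hag : X.AgreeBefore T ω ω') :
    X.AgreeBefore T ω' ω := fun v j hj => by
  have hT := h.Tmin_pos
  exact (hag v j (by rwa [← hag.start_eq' h (by linarith)])).symm

theorem AgreeBefore.inRound [Finite V] {X : Execution G Tmin Tmax Δmax}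
    (h : Admissible Tmin Δmax) {T : ℝ} {ω ω' : Coins V} (hag : X.AgreeBefore T ω ω')
    {v : V} {j : ℕ} {τ : ℝ} (hτ : τ < T + Tmin) (hj : InRound (X.start · · ω) v j τ) :
    InRound (X.start · · ω') v j τ := by
  have heq := hag.start_eq h (hj.1.trans hτ.le)
  refine ⟨heq.le.trans hj.1, ?_⟩
  by_cases hc : X.start v j ω ≤ T
  · exact hj.2.trans_eq (hag.start_eq_and h v j hc).2.symm
  · have := X.start_add_le v j ω'
    show τ < X.start v (j + 1) ω'
    linarith

/-- What is heard in a round is inherited by another outcome in which the round takes place at the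
same time, if the note is sung at the same times before the end of the round. -/
theorem hears_imp {ω ω' : Coins V} {v : V} {j k : ℕ}
    (h1 : X.start v j ω' = X.start v j ω) (h2 : X.start v (j + 1) ω' = X.start v (j + 1) ω)
    (hsing : ∀ u i τ, G.Adj u v → τ < X.start v (j + 1) ω → InRound (X.start · · ω) u i τ →
      k ∈ notes (X.state u i ω) (ell ω u i) →
      InRound (X.start · · ω') u i τ ∧ k ∈ notes (X.state u i ω') (ell ω' u i))
    (hh : X.HearsAt ω v j k) : X.HearsAt ω' v j k := by
  obtain ⟨u, huv, τ, hτ, hmem, i, hi, hk⟩ := hh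
  refine ⟨u, huv, τ, ?_, ?_, i, hsing u i τ huv hτ hi hk⟩
  · show τ < X.start v (j + 1) ω'
    rwa [h2]
  · show τ + X.delay u v τ ∈ Set.Icc (X.start v j ω') (X.start v (j + 1) ω')
    rwa [h1, h2]

theorem AgreeBefore.state_eq [Finite V] {X : Execution G Tmin Tmax Δmax}
    (h : Admissible Tmin Δmax) {T : ℝ} {ω ω' : Coins V} (hag : X.AgreeBefore T ω ω')
    {v : V} {j : ℕ} (hj : X.start v j ω ≤ T) : X.state v j ω' = X.state v j ω := by
  have hT := h.Tmin_pos
  revert hj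
  refine X.start_induction h ω (P := fun v j => X.start v j ω ≤ T →
    X.state v j ω' = X.state v j ω) ?_ v j
  intro v j ih hj
  cases j with
  | zero => rw [X.state_zero, X.state_zero]
  | succ j =>
    have hlt : X.start v j ω < X.start v (j + 1) ω := (X.start_lt_iff h).2 j.lt_succ_self
    have hst := hag.start_eq_and h v j (hlt.le.trans hj)
    have hag' := hag.symm h
    have hnotes : ∀ u i τ, τ < X.start v (j + 1) ω → InRound (X.start · · ω) u i τ →
        notes (X.state u i ω') (ell ω' u i) = notes (X.state u i ω) (ell ω u i) := by
      intro u i τ hτ hi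
      have hlt' : X.start u i ω < X.start v (j + 1) ω := hi.1.trans_lt hτ
      rw [ih u i hlt' (hlt'.le.trans hj), hag u i (hlt'.trans_le hj)]
    have hhears : ∀ k, X.HearsAt ω' v j k = X.HearsAt ω v j k := by
      refine fun k => propext ⟨X.hears_imp hst.1.symm hst.2.symm ?_, X.hears_imp hst.1 hst.2 ?_⟩
      · intro u i τ _ hτ hi hk
        rw [hst.2] at hτ
        have hi' := hag'.inRound h (by linarith) hi
        exact ⟨hi', by rwa [← hnotes u i τ hτ hi']⟩
      · intro u i τ _ hτ hi hk
        exact ⟨hag.inRound h (by linarith) hi, by rwa [hnotes u i τ hτ hi]⟩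
    rw [X.state_succ v j ω, X.state_succ v j ω', ih v j hlt (hlt.le.trans hj),
      ← hag v j (hlt.trans_le hj)]
    exact congrArg₂ _ (hhears _) (hhears _)

theorem AgreeBefore.inBy_imp [Finite V] {X : Execution G Tmin Tmax Δmax}
    (h : Admissible Tmin Δmax) {T : ℝ} {ω ω' : Coins V} (hag : X.AgreeBefore T ω ω')
    {v : V} (hv : X.InBy T ω v) : X.InBy T ω' v := by
  have hT := h.Tmin_pos
  obtain ⟨j, hj, hs⟩ := hv
  exact ⟨j, by rwa [hag.start_eq h (by linarith)], by rwa [hag.state_eq h hj]⟩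

theorem AgreeBefore.elimBy_iff [Finite V] {X : Execution G Tmin Tmax Δmax}
    (h : Admissible Tmin Δmax) {T : ℝ} {ω ω' : Coins V} (hag : X.AgreeBefore T ω ω')
    {v : V} : X.ElimBy T ω v ↔ X.ElimBy T ω' v := by
  have key : ∀ w, X.InBy T ω w ↔ X.InBy T ω' w := fun w =>
    ⟨hag.inBy_imp h, (hag.symm h).inBy_imp h⟩
  simp only [ElimBy, key]

/-- If `ω'` differs from `ω` only in a smaller `ℓ`-value of round `r` of `v`, and `v` is eliminated
by `Δmax` after the start of that round in the outcome `ω`, then it is so in `ω'` too. Indeed, the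
first change that the smaller value can cause within this time is that a neighbour of `v` which
hears its own note from `v` in `ω` does not hear it in `ω'`, and hence turns In. -/
theorem elimBy_of_ell_le [Finite V] (h : Admissible Tmin Δmax) {ω ω' : Coins V} {v : V} {r : ℕ}
    (hag : ∀ u i, (u, i) ≠ (v, r) → ell ω u i = ell ω' u i) (hle : ell ω' v r ≤ ell ω v r)
    (hv : X.ElimBy (X.start v r ω + Δmax) ω v) : X.ElimBy (X.start v r ω + Δmax) ω' v := by
  have hT := h.Tmin_pos
  have hD := h.delay_nonneg
  have h2D := h.two_delay_le
  by_contra hcon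
  have hagr : X.AgreeBefore (X.start v r ω) ω ω' := fun u i hi => hag u i fun hc => by
    rw [Prod.mk.injEq] at hc
    rw [hc.1, hc.2] at hi
    exact lt_irrefl _ hi
  have hagr' := hagr.symm h
  have hvr' : X.start v r ω' = X.start v r ω := hagr.start_eq h (by linarith)
  have hun : X.state v r ω' = .un := X.un_of_not_elimBy hcon (by linarith)
  have key : ∀ w j, X.start w j ω ≤ X.start v r ω + Δmax → X.state w j ω' = X.state w j ω := by
    refine X.start_induction h ω fun w j ih hj => ?_
    cases j with
    | zero => rw [X.state_zero, X.state_zero]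
    | succ j =>
      have hw := X.start_add_le w j ω
      have hwlt : X.start w j ω < X.start v r ω := by linarith
      have hst := hagr.start_eq_and h w j hwlt.le
      have hlt : X.start w j ω < X.start w (j + 1) ω := by linarith
      have hell : ell ω' w j = ell ω w j := (hagr w j hwlt).symm
      have hstate : ∀ u i τ, τ < X.start w (j + 1) ω → InRound (X.start · · ω) u i τ →
          X.state u i ω' = X.state u i ω := fun u i τ hτ hi =>
        ih u i (hi.1.trans_lt hτ) ((hi.1.trans_lt hτ).le.trans hj)
      have hmono : ∀ k, X.HearsAt ω' w j k → X.HearsAt ω w j k := by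
        refine fun k => X.hears_imp hst.1.symm hst.2.symm fun u i τ _ hτ hi hk => ?_
        rw [hst.2] at hτ
        have hi' := hagr'.inRound h (by linarith) hi
        refine ⟨hi', ?_⟩
        rw [hstate u i τ hτ hi'] at hk
        by_cases hui : (u, i) = (v, r)
        · rw [Prod.mk.injEq] at hui
          obtain ⟨rfl, rfl⟩ := hui
          have hs := hstate u i τ hτ hi'
          rw [hun] at hs
          rw [← hs] at hk ⊢
          exact ⟨hk.1, hk.2.trans hle⟩
        · rwa [hag u i hui]
      have hzero : X.HearsAt ω w j 0 → X.HearsAt ω' w j 0 := by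
        refine X.hears_imp hst.1 hst.2 fun u i τ _ hτ hi hk => ?_
        refine ⟨hagr.inRound h (by linarith) hi, ?_⟩
        rw [zero_mem_notes] at hk ⊢
        rw [hstate u i τ hτ hi, hk]
      have h0 : X.HearsAt ω' w j 0 = X.HearsAt ω w j 0 := propext ⟨hmono 0, hzero⟩
      have hsj : X.state w j ω' = X.state w j ω := ih w j hlt (hlt.le.trans hj)
      -- a change of state at the end of the round would be one to In, of a neighbour of `v`
      have hown : X.state w j ω = .un → ¬ X.HearsAt ω w j 0 →
          X.HearsAt ω w j (ell ω w j) → X.HearsAt ω' w j (ell ω w j) := by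
        intro hwun hw0 hh
        by_contra hno
        have hadj : G.Adj v w := by
          by_contra hnadj
          refine hno (X.hears_imp hst.1 hst.2 (fun u i τ huw hτ hi hk => ?_) hh)
          have hui : (u, i) ≠ (v, r) := fun hc => hnadj (by
            rw [Prod.mk.injEq] at hc
            rwa [← hc.1])
          refine ⟨hagr.inRound h (by linarith) hi, ?_⟩
          rwa [hstate u i τ hτ hi, ← hag u i hui]
        refine hcon (Or.inr ⟨w, hadj, j + 1, by rw [hst.2]; exact hj, ?_⟩)
        rw [isIn_succ_iff, h0, hell, hsj]
        exact ⟨hw0, Or.inr ⟨hwun, hno⟩⟩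
      rw [X.state_succ w j ω, X.state_succ w j ω', hsj, hell]
      change nextState _ (X.HearsAt ω' w j 0) (X.HearsAt ω' w j (ell ω w j)) =
        nextState _ (X.HearsAt ω w j 0) (X.HearsAt ω w j (ell ω w j))
      rw [h0]
      by_cases hc : X.state w j ω = .un ∧ ¬ X.HearsAt ω w j 0
      · rw [propext ⟨hmono (ell ω w j), hown hc.1 hc.2⟩]
      · cases hs : X.state w j ω with
        | out => rfl
        | isIn => rfl
        | un =>
          have : X.HearsAt ω w j 0 := by
            by_contra h0'
            exact hc ⟨hs, h0'⟩
          simp only [nextState, if_pos this]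
  have hin : ∀ w, X.InBy (X.start v r ω + Δmax) ω w → X.InBy (X.start v r ω + Δmax) ω' w := by
    rintro w ⟨j, hj, hs⟩
    exact ⟨j, by rwa [hagr.start_eq h (by linarith)], by rwa [key w j hj]⟩
  exact hcon (hv.imp (hin v) fun ⟨u, hu, hui⟩ => ⟨u, hu, hin u hui⟩)

/-! ### Histories -/

theorem mem_sameHistory_iff [Finite V] (h : Admissible Tmin Δmax) {t : ℝ} {ω₀ ω : Coins V} :
    ω ∈ X.sameHistory t ω₀ ↔ ∀ v j, X.start v j ω₀ ≤ t → ell ω₀ v j = ell ω v j := by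
  have hT := h.Tmin_pos
  constructor
  · intro hω v j hj
    have := congrFun (congrFun (show historyUpTo X.start t ω = historyUpTo X.start t ω₀ from hω) v) j
    simp only [historyUpTo, if_pos hj] at this
    split_ifs at this
    simp only [Option.some.injEq, Prod.mk.injEq] at this
    exact this.2.symm
  · intro hag
    have hagr : X.AgreeBefore t ω₀ ω := fun v j hj => hag v j hj.le
    show historyUpTo X.start t ω = historyUpTo X.start t ω₀
    funext v j
    unfold historyUpTo
    by_cases hc : X.start v j ω₀ ≤ t
    · have heq := hagr.start_eq h (show X.start v j ω₀ ≤ t + Tmin by linarith)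
      rw [if_pos hc, if_pos (by rwa [heq]), heq, hag v j hc]
    · rw [if_neg hc, if_neg fun hc' => hc ?_]
      rwa [← hagr.start_eq' h (by linarith)]

theorem agreeBefore_of_mem_sameHistory [Finite V] (h : Admissible Tmin Δmax) {t : ℝ}
    {ω₀ ω : Coins V} (hω : ω ∈ X.sameHistory t ω₀) : X.AgreeBefore t ω₀ ω :=
  fun v j hj => (X.mem_sameHistory_iff h).1 hω v j hj.le

theorem start_le_iff_of_mem_sameHistory [Finite V] (h : Admissible Tmin Δmax) {t : ℝ}
    {ω₀ ω : Coins V} (hω : ω ∈ X.sameHistory t ω₀) {v : V} {j : ℕ} :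
    X.start v j ω ≤ t ↔ X.start v j ω₀ ≤ t := by
  have hagr := X.agreeBefore_of_mem_sameHistory h hω
  have hT := h.Tmin_pos
  constructor <;> intro hc
  · rwa [← hagr.start_eq' h (by linarith)]
  · rwa [hagr.start_eq h (by linarith)]

/-- There is a bound, uniform over all outcomes, on the number of rounds up to a given time. -/
theorem exists_round_bound [Finite V] (h : Admissible Tmin Δmax) (T : ℝ) :
    ∃ N : ℕ, ∀ ω v j, X.start v j ω ≤ T → j < N := by
  have hv : ∀ v, ∃ N : ℕ, ∀ ω j, X.start v j ω ≤ T → j < N := fun v => by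
    obtain ⟨k, hk⟩ := X.exists_start_gt h v (fun _ => false) T
    obtain ⟨N, hN⟩ := exists_nat_gt ((T - X.start v 0 (fun _ => false)) / Tmin)
    rw [div_lt_iff₀ h.Tmin_pos] at hN
    refine ⟨N, fun ω j hj => ?_⟩
    by_contra hcon
    have h1 := X.start_add_mul_le v 0 N ω
    rw [X.start_zero_eq v ω (fun _ => false), zero_add] at h1
    have h2 : X.start v N ω ≤ X.start v j ω := (X.start_le_iff h).2 (not_lt.1 hcon)
    linarith
  choose N hN using hv
  cases nonempty_fintype V
  refine ⟨Finset.univ.sup N, fun ω v j hj => (hN v ω j hj).trans_le ?_⟩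
  exact Finset.le_sup (f := N) (Finset.mem_univ v)

end Execution
end Singing

namespace Singing

variable {V : Type*}

/-! ### Independence of the `ℓ`-values -/

/-- The event `Q` is determined by the `ℓ`-values of the rounds in `S`. -/
def DeterminedBy (S : Set (V × ℕ)) (Q : Set (Coins V)) : Prop :=
  ∀ ω ω', (∀ p ∈ S, ell ω p.1 p.2 = ell ω' p.1 p.2) → ω ∈ Q → ω' ∈ Q

/-- The σ-algebra generated by the coin flips of the rounds in `S`. -/
@[reducible]
def coinSigma (S : Set (V × ℕ)) : MeasurableSpace (Coins V) :=
  ⨆ q ∈ {q : V × ℕ × ℕ | (q.1, q.2.1) ∈ S}, MeasurableSpace.comap (fun ω : Coins V => ω q) ⊤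

theorem coinSigma_le (S : Set (V × ℕ)) : coinSigma S ≤ MeasurableSpace.pi :=
  iSup₂_le fun q _ => (measurable_pi_apply q).comap_le

theorem measurable_coin {S : Set (V × ℕ)} {v : V} {j : ℕ} (hS : (v, j) ∈ S) (m : ℕ) :
    Measurable[coinSigma S] (fun ω : Coins V => ω (v, j, m)) :=
  measurable_iff_comap_le.2 <|
    le_iSup₂_of_le (f := fun (q : V × ℕ × ℕ) (_ : q ∈ {q : V × ℕ × ℕ | (q.1, q.2.1) ∈ S}) =>
      MeasurableSpace.comap (fun ω : Coins V => ω q) ⊤) (v, j, m) hS le_rfl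

theorem lt_ell_iff {ω : Coins V} {v : V} {j k : ℕ} :
    k < ell ω v j ↔ (∀ m < k, ω (v, j, m) = true) ∧ (k = 0 ∨ ∃ m, ω (v, j, m) = false) := by
  unfold ell
  rw [Nat.lt_succ_iff]
  by_cases hne : ∃ m, ω (v, j, m) = false
  · have hne' : {m : ℕ | ω (v, j, m) = false}.Nonempty := hne
    simp only [hne, or_true, and_true]
    constructor
    · intro hk m hm
      by_contra hcon
      have := Nat.sInf_le (show m ∈ {m : ℕ | ω (v, j, m) = false} by simpa using hcon)
      omega
    · intro hk
      by_contra hcon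
      have := hk _ (not_le.1 hcon)
      rw [show ω (v, j, sInf {m : ℕ | ω (v, j, m) = false}) = false from Nat.sInf_mem hne'] at this
      cases this
  · have : {m : ℕ | ω (v, j, m) = false} = ∅ := Set.not_nonempty_iff_eq_empty.1 hne
    rw [this, Nat.sInf_empty]
    simp only [hne, or_false]
    constructor
    · intro hk
      exact ⟨fun m hm => by omega, by omega⟩
    · intro hk
      omega

theorem measurable_ell {S : Set (V × ℕ)} {v : V} {j : ℕ} (hS : (v, j) ∈ S) :
    Measurable[coinSigma S] (fun ω : Coins V => ell ω v j) := by
  refine @measurable_of_Ioi ℕ (Coins V) _ _ _ (coinSigma S) _ _ _ _ fun k => ?_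
  have : (fun ω : Coins V => ell ω v j) ⁻¹' Set.Ioi k =
      (⋂ m ∈ Set.Iio k, (fun ω : Coins V => ω (v, j, m)) ⁻¹' {true}) ∩
        ({_ω : Coins V | k = 0} ∪ ⋃ m, (fun ω : Coins V => ω (v, j, m)) ⁻¹' {false}) := by
    ext ω
    simp [lt_ell_iff]
  rw [this]
  refine MeasurableSet.inter ?_ (MeasurableSet.union (MeasurableSet.const _) ?_)
  · exact MeasurableSet.biInter (Set.to_countable _) fun m _ =>
      measurable_coin hS m (MeasurableSet.singleton _)
  · exact MeasurableSet.iUnion fun m => measurable_coin hS m (MeasurableSet.singleton _)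

theorem DeterminedBy.measurableSet_coinSigma {S : Set (V × ℕ)} (hS : S.Finite)
    {Q : Set (Coins V)} (hQ : DeterminedBy S Q) : MeasurableSet[coinSigma S] Q := by
  have := hS.to_subtype
  let f : Coins V → S → ℕ := fun ω p => ell ω p.1.1 p.1.2
  have hf : Measurable[coinSigma S] f :=
    @measurable_pi_lambda _ _ _ (coinSigma S) _ f fun p => measurable_ell p.2
  have hpre : Q = f ⁻¹' (f '' Q) := by
    refine Set.Subset.antisymm (Set.subset_preimage_image f Q) ?_
    rintro ω ⟨ω', hω', he⟩
    exact hQ ω' ω (fun p hp => congrFun he ⟨p, hp⟩) hω'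
  rw [hpre]
  exact hf (Set.to_countable _).measurableSet

theorem DeterminedBy.measurableSet {S : Set (V × ℕ)} (hS : S.Finite)
    {Q : Set (Coins V)} (hQ : DeterminedBy S Q) : MeasurableSet Q :=
  coinSigma_le S _ (hQ.measurableSet_coinSigma hS)

theorem indep_coinSigma {S S' : Set (V × ℕ)} (hSS' : Disjoint S S') :
    ProbabilityTheory.Indep (coinSigma S) (coinSigma S') (coinMeasure V) := by
  refine ProbabilityTheory.indep_iSup_of_disjoint
    (m := fun q : V × ℕ × ℕ => MeasurableSpace.comap (fun ω : Coins V => ω q) ⊤)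
    (fun q => (measurable_pi_apply q).comap_le) ?_ ?_
  · exact ProbabilityTheory.iIndepFun_infinitePi
      (P := fun _ : V × ℕ × ℕ => (PMF.uniformOfFintype Bool).toMeasure)
      (X := fun _ b => b) (fun _ => measurable_id)
  · rw [Set.disjoint_left] at hSS' ⊢
    exact fun q hq => hSS' hq

theorem measureReal_forall_lt_true (v : V) (j k : ℕ) :
    (coinMeasure V).real {ω | ∀ m < k, ω (v, j, m) = true} = (1 / 2) ^ k := by
  classical
  have hset : {ω : Coins V | ∀ m < k, ω (v, j, m) = true} =
      Set.pi ((Finset.range k).image fun m => (v, j, m)) (fun _ => {true}) := by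
    ext ω
    simp
  have hcard : ((Finset.range k).image fun m => (v, j, m)).card = k := by
    rw [Finset.card_image_of_injective _ (fun a b hab => by simpa using hab), Finset.card_range]
  have hhalf : (PMF.uniformOfFintype Bool).toMeasure {true} = 1 / 2 := by
    rw [PMF.toMeasure_uniformOfFintype_apply _ (MeasurableSet.singleton _)]
    simp
  rw [measureReal_def, hset, coinMeasure,
    Measure.infinitePi_pi (μ := fun _ : V × ℕ × ℕ => (PMF.uniformOfFintype Bool).toMeasure)
      (fun _ _ => MeasurableSet.singleton _)]
  simp [hhalf, hcard]

/-- The `ℓ`-values are geometrically distributed. -/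
theorem measureReal_lt_ell (v : V) (j k : ℕ) :
    (coinMeasure V).real {ω | k < ell ω v j} = (1 / 2) ^ k := by
  have hnull : (coinMeasure V).real {ω | ∀ m, ω (v, j, m) = true} = 0 := by
    refine le_antisymm (ge_of_tendsto' (tendsto_pow_atTop_nhds_zero_of_lt_one (r := (1 / 2 : ℝ))
      (by norm_num) (by norm_num)) fun k => ?_) measureReal_nonneg
    rw [← measureReal_forall_lt_true v j k]
    exact measureReal_mono fun ω hω m _ => hω m
  rw [← measureReal_forall_lt_true v j k]
  refine le_antisymm (measureReal_mono fun ω hω => (lt_ell_iff.1 hω).1) ?_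
  have hsub : {ω : Coins V | ∀ m < k, ω (v, j, m) = true} ⊆
      {ω | k < ell ω v j} ∪ {ω | ∀ m, ω (v, j, m) = true} := fun ω hω => by
    by_cases hall : ∀ m, ω (v, j, m) = true
    · exact Or.inr hall
    · refine Or.inl (lt_ell_iff.2 ⟨hω, Or.inr ?_⟩)
      simpa using hall
  refine (measureReal_mono hsub).trans ((measureReal_union_le _ _).trans ?_)
  rw [hnull, add_zero]

/-- The `ℓ`-value of a round is independent of any event determined by other rounds. -/
theorem DeterminedBy.measureReal_inter_lt_ell {S : Set (V × ℕ)} (hS : S.Finite)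
    {Q : Set (Coins V)} (hQ : DeterminedBy S Q) {v : V} {j : ℕ} (hvj : (v, j) ∉ S) (k : ℕ) :
    (coinMeasure V).real (Q ∩ {ω | k < ell ω v j}) = (coinMeasure V).real Q * (1 / 2) ^ k := by
  have hind := indep_coinSigma (S := S) (S' := {(v, j)}) (Set.disjoint_singleton_right.2 hvj)
  have := (ProbabilityTheory.Indep_iff _ _ _).1 hind Q {ω | k < ell ω v j}
    (hQ.measurableSet_coinSigma hS) (measurable_ell (Set.mem_singleton _) measurableSet_Ioi)
  rw [measureReal_def, this, ENNReal.toReal_mul, ← measureReal_def, ← measureReal_def,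
    measureReal_lt_ell]

theorem DeterminedBy.measureReal_inter_ell_eq {S : Set (V × ℕ)} (hS : S.Finite)
    {Q : Set (Coins V)} (hQ : DeterminedBy S Q) {v : V} {j : ℕ} (hvj : (v, j) ∉ S) (k : ℕ) :
    (coinMeasure V).real (Q ∩ {ω | ell ω v j = k + 1}) =
      (coinMeasure V).real Q * (1 / 2) ^ (k + 1) := by
  have h1 := hQ.measureReal_inter_lt_ell hS hvj k
  have h2 := hQ.measureReal_inter_lt_ell hS hvj (k + 1)
  have hm : MeasurableSet (Q ∩ {ω | k + 1 < ell ω v j}) :=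
    (hQ.measurableSet hS).inter
      (coinSigma_le _ _ (measurable_ell (Set.mem_singleton (v, j)) measurableSet_Ioi))
  have hdiff : Q ∩ {ω | ell ω v j = k + 1} =
      (Q ∩ {ω | k < ell ω v j}) \ (Q ∩ {ω | k + 1 < ell ω v j}) := by
    ext ω
    simp only [Set.mem_inter_iff, Set.mem_ofPred_eq, Set.mem_sdiff, not_and, not_lt]
    constructor
    · rintro ⟨hω, he⟩
      exact ⟨⟨hω, by omega⟩, fun _ => by omega⟩
    · rintro ⟨⟨hω, h1⟩, h2⟩
      have := h2 hω
      exact ⟨hω, by omega⟩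
  have hsub : Q ∩ {ω | k + 1 < ell ω v j} ⊆ Q ∩ {ω | k < ell ω v j} :=
    fun ω hω => ⟨hω.1, lt_trans k.lt_succ_self hω.2⟩
  rw [hdiff, measureReal_sdiff hsub hm, h1, h2]
  ring

theorem determinedBy_forall_ell_eq (F : Set (V × ℕ)) (z : V × ℕ → ℕ) :
    DeterminedBy F {ω | ∀ p ∈ F, ell ω p.1 p.2 = z p} :=
  fun _ _ heq hω p hp => (heq p hp).symm.trans (hω p hp)

theorem measureReal_forall_ell_eq_pos (F : Finset (V × ℕ)) {z : V × ℕ → ℕ} (hz : ∀ p, 0 < z p) :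
    0 < (coinMeasure V).real {ω | ∀ p ∈ F, ell ω p.1 p.2 = z p} := by
  classical
  induction F using Finset.induction_on with
  | empty => simp
  | insert p F hp ih =>
    obtain ⟨k, hk⟩ := Nat.exists_eq_succ_of_ne_zero (hz p).ne'
    have hset : {ω : Coins V | ∀ q ∈ insert p F, ell ω q.1 q.2 = z q} =
        {ω | ∀ q ∈ F, ell ω q.1 q.2 = z q} ∩ {ω | ell ω p.1 p.2 = k + 1} := by
      ext ω
      simp only [Finset.forall_mem_insert, Set.mem_ofPred_eq, Set.mem_inter_iff, hk]
      exact and_comm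
    have hdet := determinedBy_forall_ell_eq (F : Set (V × ℕ)) z
    have := hdet.measureReal_inter_ell_eq F.finite_toSet (v := p.1) (j := p.2) hp k
    rw [hset]
    refine lt_of_lt_of_eq ?_ this.symm
    exact mul_pos ih (by positivity)

open Classical in
/-- The outcome `ω` with the first coin flip of round `r` of agent `v` replaced by `0`, which makes the
`ℓ`-value of that round `1`. -/
noncomputable def lowerEll (v : V) (r : ℕ) (ω : Coins V) : Coins V :=
  Function.update ω (v, r, 0) false

theorem ell_lowerEll_self (v : V) (r : ℕ) (ω : Coins V) : ell (lowerEll v r ω) v r = 1 := by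
  have : ¬ 1 < ell (lowerEll v r ω) v r := fun hlt => by
    have := (lt_ell_iff.1 hlt).1 0 one_pos
    simp [lowerEll] at this
  have := ell_pos (lowerEll v r ω) v r
  omega

theorem ell_lowerEll_of_ne {v : V} {r : ℕ} (ω : Coins V) {u : V} {i : ℕ} (hne : (u, i) ≠ (v, r)) :
    ell (lowerEll v r ω) u i = ell ω u i := by
  have : ∀ m, lowerEll v r ω (u, i, m) = ω (u, i, m) := fun m => by
    unfold lowerEll
    classical
    refine Function.update_of_ne (fun hc => hne ?_) _ _
    simp only [Prod.mk.injEq] at hc ⊢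
    exact ⟨hc.1, hc.2.1⟩
  simp only [ell, this]

end Singing

namespace Singing
namespace Execution

variable {V : Type*} {G : SimpleGraph V} {Tmin Tmax Δmax : ℝ} (X : Execution G Tmin Tmax Δmax)

/-! ### The probability of winning a round -/

/-- Round `q + 1` of `v` is its first round that starts at or after time `s`. -/
def FirstAfter (s : ℝ) (v : V) (q : ℕ) (ω : Coins V) : Prop :=
  X.start v q ω < s ∧ s ≤ X.start v (q + 1) ω

theorem FirstAfter.unique {X : Execution G Tmin Tmax Δmax} (h : Admissible Tmin Δmax) {s : ℝ} {v : V}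
    {q q' : ℕ} {ω : Coins V} (hq : X.FirstAfter s v q ω) (hq' : X.FirstAfter s v q' ω) :
    q = q' := by
  have h1 := (X.start_lt_iff h).1 (hq.1.trans_le hq'.2)
  have h2 := (X.start_lt_iff h).1 (hq'.1.trans_le hq.2)
  omega

/-- The history up to time `t` is that of `ω₀`, all `ℓ`-values of the rounds in `S` are at most `k`,
the `ℓ`-value of the first round of `v` that starts at or after time `t + 2 * Δmax + Tmax` is more
than `k`, and `v` is not eliminated up to `Δmax` after the start of that round. -/
def wins (t : ℝ) (ω₀ : Coins V) (S : Finset (V × ℕ)) (k : ℕ) (v : V) : Set (Coins V) :=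
  {ω | ω ∈ X.sameHistory t ω₀ ∧ (∀ p ∈ S, ell ω p.1 p.2 ≤ k) ∧
    ∃ q, X.FirstAfter (t + 2 * Δmax + Tmax) v q ω ∧ k < ell ω v (q + 1) ∧
      ¬ X.ElimBy (X.start v (q + 1) ω + Δmax) ω v}

/-- The index of the first round of `v` that starts after time `t`. -/
noncomputable def roundsBy (t : ℝ) (ω : Coins V) (v : V) : ℕ := sInf {j | t < X.start v j ω}

theorem lt_start_iff (h : Admissible Tmin Δmax) {t : ℝ} {ω : Coins V} {v : V} {j : ℕ} :
    t < X.start v j ω ↔ X.roundsBy t ω v ≤ j :=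
  ⟨fun hj => Nat.sInf_le hj, fun hj =>
    lt_of_lt_of_le (Nat.sInf_mem (s := {j | t < X.start v j ω}) (X.exists_start_gt h v ω t))
      ((X.start_le_iff h).2 hj)⟩

theorem finite_index_lt [Finite V] (N : ℕ) : {p : V × ℕ | p.2 < N}.Finite := by
  refine (Set.finite_univ.prod (Set.finite_Iio N)).subset fun p hp => ⟨Set.mem_univ _, hp⟩

theorem sameHistory_determinedBy [Finite V] (h : Admissible Tmin Δmax) (t : ℝ) (ω₀ : Coins V) :
    DeterminedBy {p | X.start p.1 p.2 ω₀ ≤ t} (X.sameHistory t ω₀) := by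
  intro ω ω' hag hω
  rw [X.mem_sameHistory_iff h] at hω ⊢
  exact fun v j hj => (hω v j hj).trans (hag (v, j) hj)

theorem finite_start_le [Finite V] (h : Admissible Tmin Δmax) (t : ℝ) (ω : Coins V) :
    {p : V × ℕ | X.start p.1 p.2 ω ≤ t}.Finite :=
  (X.finite_start_lt h ω (t + 1)).subset fun p hp => by
    have : X.start p.1 p.2 ω ≤ t := hp
    show X.start p.1 p.2 ω < t + 1
    linarith

theorem measurableSet_sameHistory [Finite V] (h : Admissible Tmin Δmax) (t : ℝ) (ω₀ : Coins V) :
    MeasurableSet (X.sameHistory t ω₀) :=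
  (X.sameHistory_determinedBy h t ω₀).measurableSet (X.finite_start_le h t ω₀)

theorem measureReal_sameHistory_pos [Finite V] (h : Admissible Tmin Δmax) (t : ℝ) (ω₀ : Coins V) :
    0 < (coinMeasure V).real (X.sameHistory t ω₀) := by
  have hpos := measureReal_forall_ell_eq_pos (X.finite_start_le h t ω₀).toFinset
    (z := fun p => ell ω₀ p.1 p.2) (fun p => ell_pos _ _ _)
  refine lt_of_lt_of_eq hpos (congrArg _ ?_)
  ext ω
  rw [X.mem_sameHistory_iff h]
  simp [eq_comm]

/-- Outcomes that agree in all rounds with index less than `N`, except for the decisive round `q + 1`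
of `v`, agree before the start of that round, as `N` bounds the number of rounds until then. -/
theorem agreeBefore_firstAfter [Finite V] (h : Admissible Tmin Δmax) {t : ℝ} {N : ℕ}
    (hN : ∀ ω v j, X.start v j ω ≤ t + 2 * Δmax + 3 * Tmax → j < N) {v : V} {q : ℕ}
    {ω ω' : Coins V} (hag : ∀ p ∈ {p : V × ℕ | p.2 < N} \ {(v, q + 1)},
      ell ω p.1 p.2 = ell ω' p.1 p.2)
    (hq : X.FirstAfter (t + 2 * Δmax + Tmax) v q ω) :
    X.AgreeBefore (X.start v (q + 1) ω) ω ω' := by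
  intro w i hi
  have hT := h.Tmin_pos
  have hTT := X.Tmin_le_Tmax v
  have hq1 := hq.1
  have h1 := X.start_le_add v q ω
  have h2 := X.start_add_le v q ω
  refine hag (w, i) ⟨hN ω w i (by linarith), fun hc => ?_⟩
  rw [Set.mem_singleton_iff, Prod.mk.injEq] at hc
  rw [hc.1, hc.2] at hi
  exact lt_irrefl _ hi

theorem firstAfter_of_agreeBefore [Finite V] (h : Admissible Tmin Δmax) {s : ℝ} {v : V} {q : ℕ}
    {ω ω' : Coins V} (hag : X.AgreeBefore (X.start v (q + 1) ω) ω ω')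
    (hq : X.FirstAfter s v q ω) :
    X.start v (q + 1) ω' = X.start v (q + 1) ω ∧ X.FirstAfter s v q ω' := by
  have hT := h.Tmin_pos
  have hlt := X.start_add_le v q ω
  have h1 := hag.start_eq h (v := v) (j := q + 1) (by linarith)
  have h2 := hag.start_eq h (v := v) (j := q) (by linarith)
  exact ⟨h1, by rw [FirstAfter, h1, h2]; exact hq⟩

theorem sameHistory_imp_of_firstAfter [Finite V] (h : Admissible Tmin Δmax) {t : ℝ}
    {N : ℕ} (hN : ∀ ω v j, X.start v j ω ≤ t + 2 * Δmax + 3 * Tmax → j < N) {ω₀ : Coins V} {v : V}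
    {q : ℕ} {ω ω' : Coins V} (hag : ∀ p ∈ {p : V × ℕ | p.2 < N} \ {(v, q + 1)},
      ell ω p.1 p.2 = ell ω' p.1 p.2)
    (hq : X.FirstAfter (t + 2 * Δmax + Tmax) v q ω) (hω : ω ∈ X.sameHistory t ω₀) :
    ω' ∈ X.sameHistory t ω₀ := by
  have hD := h.delay_nonneg
  have hT := h.Tmin_pos
  have hTT := X.Tmin_le_Tmax v
  refine X.sameHistory_determinedBy h t ω₀ ω ω' (fun p hp => hag p ⟨?_, fun hc => ?_⟩) hω
  · have hp' : X.start p.1 p.2 ω₀ ≤ t := hp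
    exact hN ω₀ p.1 p.2 (by linarith)
  · rw [Set.mem_singleton_iff] at hc
    subst hc
    have := (X.start_le_iff_of_mem_sameHistory h hω).2 hp
    have := hq.2
    simp only at *
    linarith

theorem determinedBy_contest [Finite V] (h : Admissible Tmin Δmax) {t : ℝ}
    {N : ℕ} (hN : ∀ ω v j, X.start v j ω ≤ t + 2 * Δmax + 3 * Tmax → j < N) (ω₀ : Coins V) {v : V}
    (q : ℕ) {S : Finset (V × ℕ)} (hSv : ∀ p ∈ S, p.1 ≠ v) (hSN : ∀ p ∈ S, p.2 < N) (k : ℕ) :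
    DeterminedBy ({p : V × ℕ | p.2 < N} \ {(v, q + 1)})
      {ω | ω ∈ X.sameHistory t ω₀ ∧ X.FirstAfter (t + 2 * Δmax + Tmax) v q ω ∧
        ∀ p ∈ S, ell ω p.1 p.2 ≤ k} := by
  rintro ω ω' hag ⟨hω, hq, hS⟩
  have hagr := X.agreeBefore_firstAfter h hN hag hq
  refine ⟨X.sameHistory_imp_of_firstAfter h hN hag hq hω,
    (X.firstAfter_of_agreeBefore h hagr hq).2, fun p hp => ?_⟩
  rw [← hag p ⟨hSN p hp, fun hc => hSv p hp (by rw [Set.mem_singleton_iff.1 hc])⟩]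
  exact hS p hp

theorem determinedBy_elimBy_lowerEll [Finite V] (h : Admissible Tmin Δmax) {t : ℝ}
    {N : ℕ} (hN : ∀ ω v j, X.start v j ω ≤ t + 2 * Δmax + 3 * Tmax → j < N) (ω₀ : Coins V) (v : V)
    (q : ℕ) :
    DeterminedBy ({p : V × ℕ | p.2 < N} \ {(v, q + 1)})
      {ω | ω ∈ X.sameHistory t ω₀ ∧ X.FirstAfter (t + 2 * Δmax + Tmax) v q ω ∧
        X.ElimBy (X.start v (q + 1) ω + Δmax) (lowerEll v (q + 1) ω) v} := by
  rintro ω ω' hag ⟨hω, hq, hel⟩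
  have h2D := h.two_delay_le
  have hD := h.delay_nonneg
  have hTT := X.Tmin_le_Tmax v
  have hq1 := hq.1
  have h1 := X.start_le_add v q ω
  have hagr := X.agreeBefore_firstAfter h hN hag hq
  obtain ⟨hst, hq'⟩ := X.firstAfter_of_agreeBefore h hagr hq
  refine ⟨X.sameHistory_imp_of_firstAfter h hN hag hq hω, hq', ?_⟩
  rw [hst]
  have hagr' : X.AgreeBefore (X.start v (q + 1) ω + Δmax) (lowerEll v (q + 1) ω)
      (lowerEll v (q + 1) ω') := by
    intro w i hi
    by_cases hwi : (w, i) = (v, q + 1)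
    · rw [Prod.mk.injEq] at hwi
      obtain ⟨rfl, rfl⟩ := hwi
      rw [ell_lowerEll_self, ell_lowerEll_self]
    · rw [ell_lowerEll_of_ne _ hwi, ell_lowerEll_of_ne _ hwi]
      exact hag (w, i) ⟨hN _ w i (by linarith), hwi⟩
  exact (hagr'.elimBy_iff h).1 hel

theorem determinedBy_elimBy [Finite V] (h : Admissible Tmin Δmax) {t T : ℝ} (htT : t ≤ T)
    {N : ℕ} (hN : ∀ ω v j, X.start v j ω ≤ T → j < N) (ω₀ : Coins V) (v : V) :
    DeterminedBy {p : V × ℕ | p.2 < N} (X.sameHistory t ω₀ ∩ {ω | X.ElimBy T ω v}) := by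
  rintro ω ω' hag ⟨hω, hel⟩
  refine ⟨X.sameHistory_determinedBy h t ω₀ ω ω' (fun p hp => hag p ?_) hω, ?_⟩
  · exact hN ω₀ p.1 p.2 (le_trans hp htT)
  · have hagr : X.AgreeBefore T ω ω' := fun w i hi => hag (w, i) (hN ω w i hi.le)
    exact (hagr.elimBy_iff h).1 hel

theorem determinedBy_wins [Finite V] (h : Admissible Tmin Δmax) {t : ℝ}
    {N : ℕ} (hN : ∀ ω v j, X.start v j ω ≤ t + 2 * Δmax + 3 * Tmax → j < N) (ω₀ : Coins V) (v : V)
    {S : Finset (V × ℕ)} (hSN : ∀ p ∈ S, p.2 < N) (k : ℕ) :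
    DeterminedBy {p : V × ℕ | p.2 < N} (X.wins t ω₀ S k v) := by
  rintro ω ω' hag ⟨hω, hS, q, hq, hk, hel⟩
  have h2D := h.two_delay_le
  have hD := h.delay_nonneg
  have hTT := X.Tmin_le_Tmax v
  have hq1 := hq.1
  have h1 := X.start_le_add v q ω
  have hag' : ∀ p ∈ {p : V × ℕ | p.2 < N} \ {(v, q + 1)}, ell ω p.1 p.2 = ell ω' p.1 p.2 :=
    fun p hp => hag p hp.1
  have hagr := X.agreeBefore_firstAfter h hN hag' hq
  obtain ⟨hst, hq'⟩ := X.firstAfter_of_agreeBefore h hagr hq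
  have hagr' : X.AgreeBefore (X.start v (q + 1) ω + Δmax) ω ω' := fun w i hi =>
    hag (w, i) (hN ω w i (by linarith))
  refine ⟨X.sameHistory_imp_of_firstAfter h hN hag' hq hω, fun p hp => ?_, q, hq', ?_, ?_⟩
  · rw [← hag p (hSN p hp)]
    exact hS p hp
  · rwa [← hag (v, q + 1) (hN ω v (q + 1) (by linarith))]
  · rwa [hst, ← hagr'.elimBy_iff h]

/-- Events that fix different rounds of `v` as the first after `s` are disjoint. -/
theorem sum_measureReal_firstAfter [Finite V] (h : Admissible Tmin Δmax) {s : ℝ} (v : V)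
    {N : ℕ} (hN : ∀ ω q, X.FirstAfter s v q ω → q < N) {Q : ℕ → Set (Coins V)}
    (hQm : ∀ q, MeasurableSet (Q q)) (hQ : ∀ q, ∀ ω ∈ Q q, X.FirstAfter s v q ω) :
    ∑ q ∈ Finset.range N, (coinMeasure V).real (Q q) =
      (coinMeasure V).real {ω | ∃ q, ω ∈ Q q} := by
  rw [← measureReal_biUnion_finset (fun q _ q' _ hne => ?_) (fun q _ => hQm q)]
  · congr 1
    ext ω
    simp only [Set.mem_iUnion, Finset.mem_range, exists_prop, Set.mem_ofPred_eq]
    exact ⟨fun ⟨q, _, hq⟩ => ⟨q, hq⟩, fun ⟨q, hq⟩ => ⟨q, hN ω q (hQ q ω hq), hq⟩⟩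
  · exact Set.disjoint_left.2 fun ω hω hω' => hne ((hQ q ω hω).unique h (hQ q' ω hω'))

/-- A union bound: rounds after time `t` have small `ℓ`-values, whatever the history. -/
theorem le_measureReal_forall_ell_le [Finite V] (h : Admissible Tmin Δmax) {t : ℝ} (ω₀ : Coins V)
    {S : Finset (V × ℕ)} (hS : ∀ p ∈ S, t < X.start p.1 p.2 ω₀) (k : ℕ) :
    (1 - S.card * (1 / 2) ^ k) * (coinMeasure V).real (X.sameHistory t ω₀) ≤
      (coinMeasure V).real (X.sameHistory t ω₀ ∩ {ω | ∀ p ∈ S, ell ω p.1 p.2 ≤ k}) := by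
  have hsub : X.sameHistory t ω₀ ⊆ (X.sameHistory t ω₀ ∩ {ω | ∀ p ∈ S, ell ω p.1 p.2 ≤ k}) ∪
      ⋃ p ∈ S, X.sameHistory t ω₀ ∩ {ω | k < ell ω p.1 p.2} := by
    intro ω hω
    by_cases hc : ∀ p ∈ S, ell ω p.1 p.2 ≤ k
    · exact Or.inl ⟨hω, hc⟩
    · push Not at hc
      obtain ⟨p, hp, hk⟩ := hc
      exact Or.inr (Set.mem_biUnion hp ⟨hω, hk⟩)
  have hterm : ∀ p ∈ S, (coinMeasure V).real (X.sameHistory t ω₀ ∩ {ω | k < ell ω p.1 p.2}) =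
      (coinMeasure V).real (X.sameHistory t ω₀) * (1 / 2) ^ k := fun p hp =>
    (X.sameHistory_determinedBy h t ω₀).measureReal_inter_lt_ell (X.finite_start_le h t ω₀)
      (fun hc => absurd (hS p hp) (not_lt.2 hc)) k
  have h1 := (measureReal_mono (μ := coinMeasure V) hsub).trans (measureReal_union_le _ _)
  have h2 := measureReal_biUnion_finset_le (μ := coinMeasure V) S
    fun p => X.sameHistory t ω₀ ∩ {ω | k < ell ω p.1 p.2}
  rw [Finset.sum_congr rfl hterm, Finset.sum_const, nsmul_eq_mul] at h2
  nlinarith [h1, h2]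

/-- The probability of winning. The `ℓ`-value of the decisive round is independent of the rounds in
`S` and of which round it is. It is not independent of `v` being eliminated soon after the start of
the round, but a large value makes this at most twice as likely, by `elimBy_of_ell_le`. -/
theorem le_measureReal_wins [Finite V] (h : Admissible Tmin Δmax) {t : ℝ} (ht : 0 ≤ t)
    (ω₀ : Coins V) {v : V} {S : Finset (V × ℕ)}
    (hS : ∀ p ∈ S, p.1 ≠ v ∧ t < X.start p.1 p.2 ω₀) (k : ℕ) :
    (1 / 2) ^ k * ((1 - S.card * (1 / 2) ^ k) * (coinMeasure V).real (X.sameHistory t ω₀) -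
        2 * (coinMeasure V).real
          (X.sameHistory t ω₀ ∩ {ω | X.ElimBy (t + 2 * Δmax + 3 * Tmax) ω v})) ≤
      (coinMeasure V).real (X.wins t ω₀ S k v) := by
  have hT := h.Tmin_pos
  have hD := h.delay_nonneg
  have h2D := h.two_delay_le
  have hTT := X.Tmin_le_Tmax v
  have hs : 0 < t + 2 * Δmax + Tmax := by linarith
  obtain ⟨N₀, hN₀⟩ := X.exists_round_bound h (t + 2 * Δmax + 3 * Tmax)
  obtain ⟨N, hN, hSN⟩ : ∃ N, (∀ ω v j, X.start v j ω ≤ t + 2 * Δmax + 3 * Tmax → j < N) ∧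
      ∀ p ∈ S, p.2 < N := by
    refine ⟨max N₀ (S.sup Prod.snd + 1), fun ω v j hj => (hN₀ ω v j hj).trans_le (le_max_left _ _),
      fun p hp => (Nat.lt_succ_of_le (Finset.le_sup (f := Prod.snd) hp)).trans_le
        (le_max_right _ _)⟩
  have hfin : ∀ q, ({p : V × ℕ | p.2 < N} \ {(v, q + 1)}).Finite := fun q =>
    (finite_index_lt N).sdiff
  have hNq : ∀ ω q, X.FirstAfter (t + 2 * Δmax + Tmax) v q ω → q < N := fun ω q hq =>
    hN ω v q (by linarith [hq.1])
  have hmgt : ∀ q k, MeasurableSet {ω : Coins V | k < ell ω v (q + 1)} := fun q k =>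
    coinSigma_le _ _ (measurable_ell (Set.mem_singleton (v, q + 1)) measurableSet_Ioi)
  have hmeq : ∀ q k, MeasurableSet {ω : Coins V | ell ω v (q + 1) = k} := fun q k =>
    coinSigma_le _ _ (measurable_ell (Set.mem_singleton (v, q + 1)) (measurableSet_singleton k))
  -- the contest in round `q + 1`, won by a large `ℓ`-value
  set Q₁ : ℕ → Set (Coins V) := fun q =>
    {ω | ω ∈ X.sameHistory t ω₀ ∧ X.FirstAfter (t + 2 * Δmax + Tmax) v q ω ∧
      ∀ p ∈ S, ell ω p.1 p.2 ≤ k}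
  have hdet₁ : ∀ q, DeterminedBy ({p : V × ℕ | p.2 < N} \ {(v, q + 1)}) (Q₁ q) := fun q =>
    X.determinedBy_contest h hN ω₀ q (fun p hp => (hS p hp).1) hSN k
  -- elimination soon after the start of round `q + 1` if its `ℓ`-value were `1`
  set Q₂ : ℕ → Set (Coins V) := fun q =>
    {ω | ω ∈ X.sameHistory t ω₀ ∧ X.FirstAfter (t + 2 * Δmax + Tmax) v q ω ∧
      X.ElimBy (X.start v (q + 1) ω + Δmax) (lowerEll v (q + 1) ω) v}
  have hdet₂ : ∀ q, DeterminedBy ({p : V × ℕ | p.2 < N} \ {(v, q + 1)}) (Q₂ q) := fun q =>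
    X.determinedBy_elimBy_lowerEll h hN ω₀ v q
  have hsum₁ : ∑ q ∈ Finset.range N, (coinMeasure V).real (Q₁ q ∩ {ω | k < ell ω v (q + 1)}) =
      (1 / 2) ^ k * (coinMeasure V).real
        (X.sameHistory t ω₀ ∩ {ω | ∀ p ∈ S, ell ω p.1 p.2 ≤ k}) := by
    rw [Finset.sum_congr rfl fun q _ =>
      (hdet₁ q).measureReal_inter_lt_ell (hfin q) (fun hc => hc.2 rfl) k, ← Finset.sum_mul,
      X.sum_measureReal_firstAfter h v hNq (fun q => (hdet₁ q).measurableSet (hfin q))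
        (fun q ω hω => hω.2.1), mul_comm]
    congr 2
    ext ω
    constructor
    · rintro ⟨q, hω, -, hle⟩
      exact ⟨hω, hle⟩
    · rintro ⟨hω, hle⟩
      obtain ⟨q, hq⟩ := X.exists_first_start_ge h v ω hs
      exact ⟨q, hω, hq, hle⟩
  have hsum₂ : ∑ q ∈ Finset.range N, (coinMeasure V).real (Q₂ q ∩ {ω | k < ell ω v (q + 1)}) ≤
      (1 / 2) ^ k * (2 * (coinMeasure V).real
        (X.sameHistory t ω₀ ∩ {ω | X.ElimBy (t + 2 * Δmax + 3 * Tmax) ω v})) := by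
    have hterm : ∀ q ∈ Finset.range N,
        (coinMeasure V).real (Q₂ q ∩ {ω | k < ell ω v (q + 1)}) =
          (1 / 2) ^ k * (2 * (coinMeasure V).real (Q₂ q ∩ {ω | ell ω v (q + 1) = 0 + 1})) := by
      intro q _
      rw [(hdet₂ q).measureReal_inter_lt_ell (hfin q) (fun hc => hc.2 rfl),
        (hdet₂ q).measureReal_inter_ell_eq (hfin q) (fun hc => hc.2 rfl)]
      ring
    rw [Finset.sum_congr rfl hterm, ← Finset.mul_sum, ← Finset.mul_sum]
    refine mul_le_mul_of_nonneg_left (mul_le_mul_of_nonneg_left ?_ (by norm_num)) (by positivity)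
    rw [X.sum_measureReal_firstAfter h v hNq
      (fun q => ((hdet₂ q).measurableSet (hfin q)).inter (hmeq q (0 + 1)))
      (fun q ω hω => hω.1.2.1)]
    refine measureReal_mono ?_
    rintro ω ⟨q, ⟨hω, hq, hel⟩, h1⟩
    have h1' : ell ω v (q + 1) = 1 := h1
    refine ⟨hω, ?_⟩
    have hagr : X.AgreeBefore (X.start v (q + 1) ω + Δmax) (lowerEll v (q + 1) ω) ω := by
      intro w i _
      by_cases hwi : (w, i) = (v, q + 1)
      · rw [Prod.mk.injEq] at hwi
        obtain ⟨rfl, rfl⟩ := hwi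
        rw [ell_lowerEll_self, h1']
      · rw [ell_lowerEll_of_ne _ hwi]
    have hq1 := hq.1
    have h2 := X.start_le_add v q ω
    exact ((hagr.elimBy_iff h).1 hel).mono (by linarith)
  have hsum₃ : ∑ q ∈ Finset.range N, (coinMeasure V).real
      ((Q₁ q ∩ {ω | k < ell ω v (q + 1)}) \ (Q₂ q ∩ {ω | k < ell ω v (q + 1)})) ≤
        (coinMeasure V).real (X.wins t ω₀ S k v) := by
    rw [X.sum_measureReal_firstAfter h v hNq
      (fun q => (((hdet₁ q).measurableSet (hfin q)).inter (hmgt q k)).diff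
        (((hdet₂ q).measurableSet (hfin q)).inter (hmgt q k)))
      (fun q ω hω => hω.1.1.2.1)]
    refine measureReal_mono ?_
    rintro ω ⟨q, ⟨⟨hω, hq, hle⟩, hk⟩, hno⟩
    refine ⟨hω, hle, q, hq, hk, fun hel => hno ⟨⟨hω, hq, ?_⟩, hk⟩⟩
    refine X.elimBy_of_ell_le h (fun u i hne => (ell_lowerEll_of_ne ω hne).symm) ?_ hel
    rw [ell_lowerEll_self]
    exact ell_pos ω v (q + 1)
  have hdiff : ∀ q ∈ Finset.range N, (coinMeasure V).real (Q₁ q ∩ {ω | k < ell ω v (q + 1)}) ≤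
      (coinMeasure V).real
        ((Q₁ q ∩ {ω | k < ell ω v (q + 1)}) \ (Q₂ q ∩ {ω | k < ell ω v (q + 1)})) +
      (coinMeasure V).real (Q₂ q ∩ {ω | k < ell ω v (q + 1)}) := fun q _ => by
    refine (measureReal_mono ?_).trans (measureReal_union_le _ _)
    intro ω hω
    by_cases hc : ω ∈ Q₂ q ∩ {ω | k < ell ω v (q + 1)}
    · exact Or.inr hc
    · exact Or.inl ⟨hω, hc⟩
  have htot := Finset.sum_le_sum hdiff
  rw [Finset.sum_add_distrib, hsum₁] at htot
  have hunion := X.le_measureReal_forall_ell_le h ω₀ (fun p hp => (hS p hp).2) k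
  have := mul_le_mul_of_nonneg_left hunion (show (0 : ℝ) ≤ (1 / 2) ^ k by positivity)
  linarith

end Execution
end Singing

namespace Singing

/-! ### Two counting lemmas for graphs -/

section Graph

variable {V : Type*} [Fintype V] (A : SimpleGraph V) [DecidableRel A.Adj]

/-- Each edge with an endpoint in `L` is counted at most twice in the sum of the degrees over `L`. -/
theorem sum_degree_le_two_mul_card [DecidableEq V] (L : Finset V) :
    ∑ u ∈ L, A.degree u ≤ 2 * (A.edgeFinset.filter fun e => ∃ v ∈ e, v ∈ L).card := by
  have h1 : ∀ u ∈ L, A.degree u = (A.edgeFinset.filter fun e => u ∈ e).card := fun u _ => by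
    rw [← A.incidenceFinset_eq_filter, A.card_incidenceFinset_eq_degree]
  rw [Finset.sum_congr rfl h1]
  have h2 := Finset.sum_card_bipartiteAbove_eq_sum_card_bipartiteBelow (s := L)
    (t := A.edgeFinset) (fun u e => u ∈ e)
  simp only [Finset.bipartiteAbove, Finset.bipartiteBelow] at h2
  rw [h2, Finset.card_filter, Finset.mul_sum]
  refine Finset.sum_le_sum fun e _ => ?_
  split_ifs with hc
  · rw [mul_one]
    induction e using Sym2.ind with
    | _ a b =>
      refine (Finset.card_le_card (t := {a, b}) fun u hu => ?_).trans Finset.card_le_two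
      simpa using (Finset.mem_filter.1 hu).2
  · rw [mul_zero, Nat.le_zero, Finset.card_eq_zero, Finset.filter_eq_empty_iff]
    exact fun u hu hue => hc ⟨u, hue, hu⟩

/-- If `q u` is at least the sum of `(c - q v) / (K * (d u + d v))` over the neighbours `v` of `u`,
then the sum of `d u * q u` is at least of the order of `c / K` times the number of edges: before
the correction by `- q v`, the two directions of an edge contribute `c / K` in total. -/
theorem mul_card_edgeFinset_le {q : V → ℝ} (hq : ∀ v, 0 ≤ q v) {c K : ℝ} (hK : 0 < K)
    (hsum : ∀ u, ∑ v ∈ A.neighborFinset u, (c - q v) / (K * (A.degree u + A.degree v)) ≤ q u) :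
    c * A.edgeFinset.card ≤ (K + 1) * ∑ u, A.degree u * q u := by
  have hdeg : ∀ u v, A.Adj u v → (0 : ℝ) < A.degree u := fun u v huv => by
    have : 0 < A.degree u := (A.degree_pos_iff_exists_adj u).2 ⟨v, huv⟩
    exact_mod_cast this
  have hite : ∀ (u : V) (f : V → ℝ), ∑ v ∈ A.neighborFinset u, f v =
      ∑ v, if A.Adj u v then f v else 0 := fun u f => by
    rw [A.neighborFinset_eq_filter, Finset.sum_filter]
  have hdegsum : ∀ u, (A.degree u : ℝ) = ∑ v, if A.Adj u v then (1 : ℝ) else 0 := fun u => by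
    rw [← hite]
    simp
  set F : ℝ := ∑ u, ∑ v, if A.Adj u v then (A.degree u : ℝ) / (A.degree u + A.degree v) else 0
    with hF
  have hFcard : F = A.edgeFinset.card := by
    have h1 : F = ∑ u, ∑ v,
        if A.Adj u v then (A.degree v : ℝ) / (A.degree u + A.degree v) else 0 := by
      rw [hF, Finset.sum_comm]
      refine Finset.sum_congr rfl fun u _ => Finset.sum_congr rfl fun v _ => ?_
      simp only [A.adj_comm v u, add_comm (A.degree v : ℝ)]
    have h2 : F + F = ∑ u, ∑ v, if A.Adj u v then (1 : ℝ) else 0 := by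
      nth_rewrite 2 [h1]
      rw [hF, ← Finset.sum_add_distrib]
      refine Finset.sum_congr rfl fun u _ => ?_
      rw [← Finset.sum_add_distrib]
      refine Finset.sum_congr rfl fun v _ => ?_
      split_ifs with huv
      · have h3 := hdeg u v huv
        have h4 := hdeg v u huv.symm
        field_simp
      · simp
    have h3 : (∑ u, (A.degree u : ℝ)) = 2 * A.edgeFinset.card := by
      exact_mod_cast A.sum_degrees_eq_twice_card_edges
    simp only [← hdegsum] at h2
    linarith
  have hloss : (∑ u, ∑ v,
      if A.Adj u v then (A.degree u : ℝ) * q v / (A.degree u + A.degree v) else 0) ≤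
      ∑ u, A.degree u * q u := by
    rw [Finset.sum_comm]
    refine Finset.sum_le_sum fun v _ => ?_
    have hr : (A.degree v : ℝ) * q v = ∑ u, if A.Adj u v then q v else 0 := by
      rw [hdegsum v, Finset.sum_mul]
      refine Finset.sum_congr rfl fun u _ => ?_
      simp only [A.adj_comm v u, ite_mul, one_mul, zero_mul]
    rw [hr]
    refine Finset.sum_le_sum fun u _ => ?_
    split_ifs with huv
    · have h3 := hdeg u v huv
      have h4 := hdeg v u huv.symm
      rw [div_le_iff₀ (by positivity)]
      nlinarith [mul_nonneg (hq v) h4.le]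
    · exact le_rfl
  have hmain : ∀ u, (∑ v, if A.Adj u v then
      c * ((A.degree u : ℝ) / (A.degree u + A.degree v)) else 0) -
      (∑ v, if A.Adj u v then (A.degree u : ℝ) * q v / (A.degree u + A.degree v) else 0) ≤
      K * (A.degree u * q u) := fun u => by
    have h1 := mul_le_mul_of_nonneg_left (hsum u) (show (0 : ℝ) ≤ K * A.degree u by positivity)
    rw [hite, Finset.mul_sum] at h1
    rw [← Finset.sum_sub_distrib, ← mul_assoc]
    refine le_trans (le_of_eq (Finset.sum_congr rfl fun v _ => ?_)) h1
    split_ifs with huv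
    · have h3 := hdeg u v huv
      have h4 := hdeg v u huv.symm
      field_simp
    · simp
  have htot := Finset.sum_le_sum fun u (_ : u ∈ Finset.univ) => hmain u
  rw [Finset.sum_sub_distrib, ← Finset.mul_sum] at htot
  have hFc : (∑ u, ∑ v, if A.Adj u v then
      c * ((A.degree u : ℝ) / (A.degree u + A.degree v)) else 0) = c * F := by
    rw [hF, Finset.mul_sum]
    refine Finset.sum_congr rfl fun u _ => ?_
    rw [Finset.mul_sum]
    exact Finset.sum_congr rfl fun v _ => by split_ifs <;> simp
  rw [hFc, hFcard] at htot
  linarith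

end Graph

namespace Execution

variable {V : Type*} {G : SimpleGraph V} {Tmin Tmax Δmax : ℝ} (X : Execution G Tmin Tmax Δmax)

/-! ### The expected loss of active edges -/

/-- The graph of the active edges at time `t`. -/
def activeGraph (t : ℝ) (ω : Coins V) : SimpleGraph V where
  Adj u v := G.Adj u v ∧ ¬ X.ElimBy t ω u ∧ ¬ X.ElimBy t ω v
  symm := ⟨fun _ _ huv => ⟨huv.1.symm, huv.2.2, huv.2.1⟩⟩
  loopless := ⟨fun _ hu => hu.1.ne rfl⟩

theorem edgeSet_activeGraph [Finite V] (h : Admissible Tmin Δmax) {t : ℝ} (ht : 0 ≤ t)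
    (ω : Coins V) : (X.activeGraph t ω).edgeSet = X.activeEdges t ω := by
  ext e
  induction e using Sym2.ind with
  | _ u v => rw [SimpleGraph.mem_edgeSet, X.mem_activeEdges_iff h ht]; rfl

open Classical in
/-- The rounds that an agent `v` has to beat in order to eliminate its neighbour `u` ahead of all
other neighbours of `u`: for each agent other than `v` that is adjacent to `u` or `v` by an active
edge at time `t`, the next `K` rounds. -/
noncomputable def rivals [Fintype V] (t : ℝ) (ω : Coins V) (K : ℕ) (u v : V) : Finset (V × ℕ) :=
  ((((X.activeGraph t ω).neighborFinset u ∪ (X.activeGraph t ω).neighborFinset v).erase v) ×ˢ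
    Finset.range K).image fun p => (p.1, X.roundsBy t ω p.1 + p.2)

theorem card_rivals_le [Fintype V] (t : ℝ) (ω : Coins V) (K : ℕ) (u v : V)
    [DecidableRel (X.activeGraph t ω).Adj] :
    (X.rivals t ω K u v).card ≤
      K * ((X.activeGraph t ω).degree u + (X.activeGraph t ω).degree v) := by
  classical
  refine Finset.card_image_le.trans ?_
  rw [Finset.card_product, Finset.card_range, mul_comm]
  refine Nat.mul_le_mul_left _ ((Finset.card_le_card (Finset.erase_subset _ _)).trans ?_)
  refine (Finset.card_union_le _ _).trans (le_of_eq ?_)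
  simp only [SimpleGraph.card_neighborFinset_eq_degree]
  congr!

theorem mem_rivals_iff [Fintype V] {t : ℝ} {ω : Coins V} {K : ℕ} {u v w : V} {i : ℕ} :
    (w, i) ∈ X.rivals t ω K u v ↔ w ≠ v ∧
      ((X.activeGraph t ω).Adj u w ∨ (X.activeGraph t ω).Adj v w) ∧
      X.roundsBy t ω w ≤ i ∧ i < X.roundsBy t ω w + K := by
  classical
  simp only [rivals, Finset.mem_image, Finset.mem_product, Finset.mem_erase, Finset.mem_union,
    SimpleGraph.mem_neighborFinset, Finset.mem_range, Prod.exists, Prod.mk.injEq]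
  constructor
  · rintro ⟨w', i', ⟨⟨hne, hadj⟩, hi'⟩, rfl, rfl⟩
    exact ⟨hne, hadj, by omega, by omega⟩
  · rintro ⟨hne, hadj, h1, h2⟩
    exact ⟨w, i - X.roundsBy t ω w, ⟨⟨hne, hadj⟩, by omega⟩, rfl, by omega⟩

/-- If `K` rounds of minimal length take at least `2 * Δmax + 3 * Tmax`, then the next `K` rounds of
an agent include all its rounds that start within this time after `t`. -/
theorem roundsBy_le_and_lt [Finite V] (h : Admissible Tmin Δmax) {t : ℝ} {ω₀ ω : Coins V}
    (hω : ω ∈ X.sameHistory t ω₀) {K : ℕ} (hK : 2 * Δmax + 3 * Tmax ≤ K * Tmin) {w : V} {i : ℕ}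
    (h1 : t < X.start w i ω) (h2 : X.start w i ω < t + 2 * Δmax + 3 * Tmax) :
    X.roundsBy t ω₀ w ≤ i ∧ i < X.roundsBy t ω₀ w + K := by
  have hiff : ∀ j, X.roundsBy t ω₀ w ≤ j ↔ t < X.start w j ω := fun j => by
    rw [← X.lt_start_iff h, ← not_le, ← not_le, X.start_le_iff_of_mem_sameHistory h hω]
  refine ⟨(hiff i).2 h1, ?_⟩
  by_contra hcon
  have h3 := (hiff _).1 le_rfl
  have h4 := X.start_add_mul_le w (X.roundsBy t ω₀ w) K ω
  have h5 : X.start w (X.roundsBy t ω₀ w + K) ω ≤ X.start w i ω :=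
    (X.start_le_iff h).2 (not_lt.1 hcon)
  linarith

/-- An agent that beats its rivals eliminates its neighbour. -/
theorem elimBy_of_mem_wins [Fintype V] (h : Admissible Tmin Δmax) {t : ℝ} (ht : 0 ≤ t)
    {ω₀ ω : Coins V} {K k : ℕ} (hK : 2 * Δmax + 3 * Tmax ≤ K * Tmin) {u v : V}
    (huv : (X.activeGraph t ω₀).Adj u v) (hω : ω ∈ X.wins t ω₀ (X.rivals t ω₀ K u v) k v) :
    X.ElimBy (t + 2 * Δmax + 3 * Tmax) ω u := by
  obtain ⟨hH, hle, q, hq, hk, hel⟩ := hω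
  have h1 := X.start_le_add v q ω
  have h2 := X.start_le_add v (q + 1) ω
  have hq1 := hq.1
  refine Or.inr ⟨v, huv.1, q + 1 + 1, by linarith, ?_⟩
  refine X.isIn_succ_of_wins h ht hq.2 (by linarith) hel fun x hx hxe i hi1 hi2 => ?_
  have hxe' : ¬ X.ElimBy t ω₀ x := by
    rwa [(X.agreeBefore_of_mem_sameHistory h hH).elimBy_iff h]
  have hmem : (x, i) ∈ X.rivals t ω₀ K u v :=
    X.mem_rivals_iff.2 ⟨hx.ne', Or.inr ⟨hx, huv.2.2, hxe'⟩,
      X.roundsBy_le_and_lt h hH hK hi1 hi2⟩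
  exact (hle _ hmem).trans_lt hk

/-- Two agents do not both beat their rivals for the same neighbour. -/
theorem disjoint_wins [Fintype V] (h : Admissible Tmin Δmax) {t : ℝ}
    {ω₀ : Coins V} {K k k' : ℕ} (hK : 2 * Δmax + 3 * Tmax ≤ K * Tmin) {u v v' : V} (hne : v ≠ v')
    (huv : (X.activeGraph t ω₀).Adj u v) (huv' : (X.activeGraph t ω₀).Adj u v') :
    Disjoint (X.wins t ω₀ (X.rivals t ω₀ K u v) k v)
      (X.wins t ω₀ (X.rivals t ω₀ K u v') k' v') := by
  have hD := h.delay_nonneg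
  have hT := h.Tmin_pos
  have hTT := X.Tmin_le_Tmax v
  have key : ∀ {v v' : V} {k k' : ℕ} {ω : Coins V}, v ≠ v' → (X.activeGraph t ω₀).Adj u v →
      ω ∈ X.wins t ω₀ (X.rivals t ω₀ K u v) k v →
      ω ∈ X.wins t ω₀ (X.rivals t ω₀ K u v') k' v' → k < k' := by
    rintro v v' k k' ω hne huv ⟨hH, -, q, hq, hk, -⟩ ⟨-, hle, -⟩
    have h1 := X.start_le_add v q ω
    have hq1 := hq.1
    have hq2 := hq.2
    have hmem : (v, q + 1) ∈ X.rivals t ω₀ K u v' := X.mem_rivals_iff.2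
      ⟨hne, Or.inl huv, X.roundsBy_le_and_lt h hH hK (by linarith) (by linarith)⟩
    exact hk.trans_le (hle _ hmem)
  exact Set.disjoint_left.2 fun ω hω hω' =>
    lt_asymm (key hne huv hω hω') (key hne.symm huv' hω' hω)

/-- The threshold for the `ℓ`-value that is used against `m` rivals. -/
theorem exists_threshold {m : ℕ} (hm : 0 < m) :
    ∃ k : ℕ, 2 * (m : ℝ) * (1 / 2) ^ k ≤ 1 ∧ 1 ≤ 4 * (m : ℝ) * (1 / 2) ^ k := by
  refine ⟨Nat.clog 2 (2 * m), ?_, ?_⟩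
  · have h1 : 2 * m ≤ 2 ^ Nat.clog 2 (2 * m) := Nat.le_pow_clog one_lt_two _
    have h2 : (2 * m : ℝ) ≤ 2 ^ Nat.clog 2 (2 * m) := by exact_mod_cast h1
    rw [one_div, inv_pow, ← div_eq_mul_inv, div_le_one (by positivity)]
    exact h2
  · have h1 := Nat.pow_pred_clog_lt_self one_lt_two (show 1 < 2 * m by omega)
    have hpos : 0 < Nat.clog 2 (2 * m) := Nat.clog_pos one_lt_two (by omega)
    obtain ⟨j, hj⟩ := Nat.exists_eq_succ_of_ne_zero hpos.ne'
    rw [hj] at h1 ⊢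
    have h2 : ((2 : ℝ) ^ j) < 2 * m := by exact_mod_cast h1
    rw [one_div, inv_pow, ← div_eq_mul_inv, one_le_div (by positivity), pow_succ]
    linarith

/-- The probability of eliminating a given neighbour. -/
theorem exists_le_measureReal_wins [Fintype V] (h : Admissible Tmin Δmax) {t : ℝ} (ht : 0 ≤ t)
    (ω₀ : Coins V) [DecidableRel (X.activeGraph t ω₀).Adj] {K : ℕ} (hK : 0 < K) {u v : V}
    (huv : (X.activeGraph t ω₀).Adj u v) :
    ∃ k, ((coinMeasure V).real (X.sameHistory t ω₀) / 8 -
        (coinMeasure V).real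
          (X.sameHistory t ω₀ ∩ {ω | X.ElimBy (t + 2 * Δmax + 3 * Tmax) ω v})) /
        (K * ((X.activeGraph t ω₀).degree u + (X.activeGraph t ω₀).degree v)) ≤
      (coinMeasure V).real (X.wins t ω₀ (X.rivals t ω₀ K u v) k v) := by
  have hdpos : 0 < (X.activeGraph t ω₀).degree u :=
    ((X.activeGraph t ω₀).degree_pos_iff_exists_adj u).2 ⟨v, huv⟩
  set m : ℕ := K * ((X.activeGraph t ω₀).degree u + (X.activeGraph t ω₀).degree v) with hm
  have hmpos : 0 < m := Nat.mul_pos hK (by omega)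
  obtain ⟨k, hk1, hk2⟩ := exists_threshold hmpos
  refine ⟨k, le_trans ?_ (X.le_measureReal_wins h ht ω₀ (v := v) (fun p hp => ?_) k)⟩
  · have hcard : ((X.rivals t ω₀ K u v).card : ℝ) ≤ m := by
      exact_mod_cast X.card_rivals_le t ω₀ K u v
    have hcast : (K : ℝ) * ((X.activeGraph t ω₀).degree u + (X.activeGraph t ω₀).degree v) = m := by
      rw [hm]; push_cast; ring
    rw [hcast, div_le_iff₀ (by exact_mod_cast hmpos)]
    have hmr : (0 : ℝ) < m := by exact_mod_cast hmpos
    set y : ℝ := (1 / 2) ^ k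
    have hy : 0 < y := by positivity
    set a := (coinMeasure V).real (X.sameHistory t ω₀)
    have ha : 0 ≤ a := measureReal_nonneg
    set b := (coinMeasure V).real
      (X.sameHistory t ω₀ ∩ {ω | X.ElimBy (t + 2 * Δmax + 3 * Tmax) ω v})
    have hb : 0 ≤ b := measureReal_nonneg
    set s : ℝ := ((X.rivals t ω₀ K u v).card : ℝ)
    have h1 : (1 / 2) * a ≤ (1 - s * y) * a := by
      refine mul_le_mul_of_nonneg_right ?_ ha
      nlinarith
    have h2 : y * ((1 / 2) * a - 2 * b) * m ≤ y * ((1 - s * y) * a - 2 * b) * m :=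
      mul_le_mul_of_nonneg_right (mul_le_mul_of_nonneg_left (by linarith) hy.le) hmr.le
    refine le_trans ?_ h2
    nlinarith [mul_nonneg ha (sub_nonneg.2 hk2), mul_nonneg hb (sub_nonneg.2 hk1)]
  · obtain ⟨h1, -, h2, -⟩ := X.mem_rivals_iff.1 (show (p.1, p.2) ∈ _ from hp)
    exact ⟨h1, (X.lt_start_iff h).2 h2⟩

/-- The probability that `u` is eliminated in the next `2 * Δmax + 3 * Tmax` units of time. -/
theorem sum_le_measureReal_elimBy [Fintype V] (h : Admissible Tmin Δmax) {t : ℝ} (ht : 0 ≤ t)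
    (ω₀ : Coins V) [DecidableRel (X.activeGraph t ω₀).Adj] {K : ℕ} (hK : 0 < K)
    (hKT : 2 * Δmax + 3 * Tmax ≤ K * Tmin) (u : V) :
    ∑ v ∈ (X.activeGraph t ω₀).neighborFinset u,
      ((coinMeasure V).real (X.sameHistory t ω₀) / 8 -
        (coinMeasure V).real
          (X.sameHistory t ω₀ ∩ {ω | X.ElimBy (t + 2 * Δmax + 3 * Tmax) ω v})) /
        (K * ((X.activeGraph t ω₀).degree u + (X.activeGraph t ω₀).degree v)) ≤
      (coinMeasure V).real
        (X.sameHistory t ω₀ ∩ {ω | X.ElimBy (t + 2 * Δmax + 3 * Tmax) ω u}) := by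
  have hadj : ∀ v ∈ (X.activeGraph t ω₀).neighborFinset u, (X.activeGraph t ω₀).Adj u v :=
    fun v hv => ((X.activeGraph t ω₀).mem_neighborFinset u v).1 hv
  have hex : ∀ v, ∃ k, (X.activeGraph t ω₀).Adj u v →
      ((coinMeasure V).real (X.sameHistory t ω₀) / 8 -
        (coinMeasure V).real
          (X.sameHistory t ω₀ ∩ {ω | X.ElimBy (t + 2 * Δmax + 3 * Tmax) ω v})) /
        (K * ((X.activeGraph t ω₀).degree u + (X.activeGraph t ω₀).degree v)) ≤
      (coinMeasure V).real (X.wins t ω₀ (X.rivals t ω₀ K u v) k v) := fun v => by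
    by_cases huv : (X.activeGraph t ω₀).Adj u v
    · obtain ⟨k, hk⟩ := X.exists_le_measureReal_wins h ht ω₀ hK huv
      exact ⟨k, fun _ => hk⟩
    · exact ⟨0, fun hc => absurd hc huv⟩
  choose k hk using hex
  refine (Finset.sum_le_sum fun v hv => hk v (hadj v hv)).trans ?_
  obtain ⟨N₀, hN₀⟩ := X.exists_round_bound h (t + 2 * Δmax + 3 * Tmax)
  rw [← measureReal_biUnion_finset]
  · refine measureReal_mono fun ω hω => ?_
    obtain ⟨v, hv, hω⟩ := Set.mem_iUnion₂.1 hω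
    exact ⟨hω.1, X.elimBy_of_mem_wins h ht hKT (hadj v hv) hω⟩
  · exact fun v hv v' hv' hne => X.disjoint_wins h hKT hne (hadj v hv) (hadj v' hv')
  · intro v hv
    refine (X.determinedBy_wins h (N := max N₀ ((X.rivals t ω₀ K u v).sup Prod.snd + 1))
      (fun ω v j hj => (hN₀ ω v j hj).trans_le (le_max_left _ _)) ω₀ v (fun p hp => ?_)
      (k v)).measurableSet (finite_index_lt _)
    exact (Nat.lt_succ_of_le (Finset.le_sup (f := Prod.snd) hp)).trans_le (le_max_right _ _)

theorem numActive_eq_card [Fintype V] (h : Admissible Tmin Δmax) {t : ℝ} (ht : 0 ≤ t) (ω : Coins V)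
    [Fintype (X.activeGraph t ω).edgeSet] :
    X.numActive t ω = (X.activeGraph t ω).edgeFinset.card := by
  rw [numActive, ← X.edgeSet_activeGraph h ht, ← Set.ncard_coe_finset,
    SimpleGraph.coe_edgeFinset]

open Classical in
/-- Edges whose endpoints are eliminated later get lost. -/
theorem numActive_le [Fintype V] (h : Admissible Tmin Δmax) {t t' : ℝ} (ht : 0 ≤ t) (htt' : t ≤ t')
    {ω₀ ω : Coins V} (hω : ω ∈ X.sameHistory t ω₀) :
    X.numActive t' ω ≤ X.numActive t ω₀ -
      (∑ u, if X.ElimBy t' ω u then ((X.activeGraph t ω₀).degree u : ℝ) else 0) / 2 := by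
  set L : Finset V := Finset.univ.filter fun u => X.ElimBy t' ω u with hL
  have hcount := sum_degree_le_two_mul_card (X.activeGraph t ω₀) L
  have hsplit := Finset.card_filter_add_card_filter_not (s := (X.activeGraph t ω₀).edgeFinset)
    (fun e => ∃ v ∈ e, v ∈ L)
  have hsub : X.activeEdges t' ω ⊆
      ((X.activeGraph t ω₀).edgeFinset.filter fun e => ¬ ∃ v ∈ e, v ∈ L : Finset (Sym2 V)) := by
    intro e
    induction e using Sym2.ind with
    | _ a b =>
      rw [X.mem_activeEdges_iff h (ht.trans htt')]
      rintro ⟨hab, ha, hb⟩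
      have hagr := X.agreeBefore_of_mem_sameHistory h hω
      simp only [Finset.coe_filter, SimpleGraph.mem_edgeFinset, Set.mem_ofPred_eq]
      refine ⟨⟨hab, fun hc => ha ?_, fun hc => hb ?_⟩, ?_⟩
      · exact ((hagr.elimBy_iff h).1 hc).mono htt'
      · exact ((hagr.elimBy_iff h).1 hc).mono htt'
      · rintro ⟨v, hv, hvL⟩
        have hvL' : X.ElimBy t' ω v := (Finset.mem_filter.1 hvL).2
        rcases Sym2.mem_iff.1 hv with rfl | rfl
        · exact ha hvL'
        · exact hb hvL'
  have hle := Set.ncard_le_ncard hsub (Finset.finite_toSet _)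
  rw [Set.ncard_coe_finset] at hle
  rw [X.numActive_eq_card h ht ω₀, ← Finset.sum_filter, ← hL, numActive]
  have h1 : ((∑ u ∈ L, (X.activeGraph t ω₀).degree u : ℕ) : ℝ) ≤
      ((2 * ((X.activeGraph t ω₀).edgeFinset.filter fun e => ∃ v ∈ e, v ∈ L).card : ℕ) : ℝ) :=
    Nat.cast_le.2 hcount
  have h2 : (((X.activeEdges t' ω).ncard : ℕ) : ℝ) ≤
      (((X.activeGraph t ω₀).edgeFinset.filter fun e => ¬ ∃ v ∈ e, v ∈ L).card : ℝ) :=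
    Nat.cast_le.2 hle
  have h3 : ((((X.activeGraph t ω₀).edgeFinset.filter fun e => ∃ v ∈ e, v ∈ L).card +
      ((X.activeGraph t ω₀).edgeFinset.filter fun e => ¬ ∃ v ∈ e, v ∈ L).card : ℕ) : ℝ) =
      ((X.activeGraph t ω₀).edgeFinset.card : ℝ) := congrArg _ hsplit
  push_cast at h1 h3
  linarith

theorem integrable_numActive [Fintype V] (h : Admissible Tmin Δmax) {t : ℝ} (ht : 0 ≤ t) :
    Integrable (X.numActive t) (coinMeasure V) := by
  obtain ⟨N, hN⟩ := X.exists_round_bound h t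
  have hmeas : Measurable (X.numActive t) := fun B _ => by
    refine DeterminedBy.measurableSet (S := {p : V × ℕ | p.2 < N}) (finite_index_lt N) ?_
    intro ω ω' hag hω
    have hagr : X.AgreeBefore t ω ω' := fun w i hi => hag (w, i) (hN ω w i hi.le)
    have heq : X.numActive t ω' = X.numActive t ω := by
      rw [numActive, numActive, activeEdges, activeEdges]
      simp only [X.eliminated_iff h ht, hagr.elimBy_iff h]
    rw [Set.mem_preimage, heq]
    exact hω
  refine Integrable.of_bound hmeas.aestronglyMeasurable (Nat.card (Sym2 V) : ℝ)
    (Filter.Eventually.of_forall fun ω => ?_)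
  rw [numActive, Real.norm_natCast]
  exact_mod_cast Set.ncard_le_card _

/-- **Expected loss.** The bound on the active edges after a period of length `Tdiff`, integrated over
the event of a given history rather than conditioned on it. -/
theorem setIntegral_numActive_le [Fintype V] [Nonempty V] (h : Admissible Tmin Δmax) {t : ℝ}
    (ht : 0 ≤ t) (ω₀ : Coins V) {Tdiff : ℝ} (hTd : Tdiff = 2 * Δmax + 3 * Tmax) :
    ∫ ω in X.sameHistory t ω₀, X.numActive (t + Tdiff) ω ∂(coinMeasure V) ≤
      (X.numActive t ω₀ - X.numActive t ω₀ / 28 * (Tmin / Tdiff)) *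
        (coinMeasure V).real (X.sameHistory t ω₀) := by
  classical
  have hT := h.Tmin_pos
  have hD := h.delay_nonneg
  have hTT := X.Tmin_le_Tmax (Classical.arbitrary V)
  have hTdpos : 0 < Tdiff := by linarith
  have htT : t + Tdiff = t + 2 * Δmax + 3 * Tmax := by rw [hTd]; ring
  have hx : 3 ≤ Tdiff / Tmin := by rw [le_div_iff₀ hT]; linarith
  set K : ℕ := ⌈Tdiff / Tmin⌉₊ with hKdef
  have hK1 : Tdiff / Tmin ≤ K := Nat.le_ceil _
  have hK2 : (K : ℝ) < Tdiff / Tmin + 1 := Nat.ceil_lt_add_one (by linarith)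
  have hKpos : 0 < K := Nat.ceil_pos.2 (by linarith)
  have hKT : 2 * Δmax + 3 * Tmax ≤ K * Tmin := by
    rw [← hTd]
    exact (div_le_iff₀ hT).1 hK1
  set a := (coinMeasure V).real (X.sameHistory t ω₀) with ha
  have ha0 : 0 ≤ a := measureReal_nonneg
  set q : V → ℝ := fun v => (coinMeasure V).real
    (X.sameHistory t ω₀ ∩ {ω | X.ElimBy (t + 2 * Δmax + 3 * Tmax) ω v}) with hq
  have hgraph := mul_card_edgeFinset_le (X.activeGraph t ω₀) (q := q)
    (fun _ => measureReal_nonneg) (c := a / 8) (K := K) (by exact_mod_cast hKpos)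
    (fun u => X.sum_le_measureReal_elimBy h ht ω₀ hKpos hKT u)
  rw [← X.numActive_eq_card h ht ω₀] at hgraph
  set Y : ℝ := ∑ u, (X.activeGraph t ω₀).degree u * q u with hY
  have hint : ∫ ω in X.sameHistory t ω₀, X.numActive (t + Tdiff) ω ∂(coinMeasure V) ≤
      X.numActive t ω₀ * a - Y / 2 := by
    have hHm := X.measurableSet_sameHistory h t ω₀
    obtain ⟨N, hN⟩ := X.exists_round_bound h (t + 2 * Δmax + 3 * Tmax)
    have hEm : ∀ u, MeasurableSet
        (X.sameHistory t ω₀ ∩ {ω | X.ElimBy (t + 2 * Δmax + 3 * Tmax) ω u}) := fun u =>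
      (X.determinedBy_elimBy h (by linarith) hN ω₀ u).measurableSet (finite_index_lt N)
    have hi1 : Integrable ((X.sameHistory t ω₀).indicator fun _ => X.numActive t ω₀)
        (coinMeasure V) := (integrable_const _).indicator hHm
    have hi2 : ∀ u ∈ Finset.univ, Integrable
        ((X.sameHistory t ω₀ ∩ {ω | X.ElimBy (t + 2 * Δmax + 3 * Tmax) ω u}).indicator
          fun _ => ((X.activeGraph t ω₀).degree u : ℝ) / 2) (coinMeasure V) :=
      fun u _ => (integrable_const _).indicator (hEm u)
    rw [← integral_indicator hHm]
    refine (integral_mono ((X.integrable_numActive h (by linarith)).indicator hHm)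
      (hi1.sub (integrable_finsetSum _ hi2)) fun ω => ?_).trans (le_of_eq ?_)
    · simp only [Pi.sub_apply]
      by_cases hω : ω ∈ X.sameHistory t ω₀
      · have := X.numActive_le h ht (show t ≤ t + Tdiff by linarith) hω
        rw [Finset.sum_div] at this
        rw [Set.indicator_of_mem hω, Set.indicator_of_mem hω]
        refine this.trans (le_of_eq (congrArg _ (Finset.sum_congr rfl fun u _ => ?_)))
        rw [← htT]
        by_cases hu : X.ElimBy (t + Tdiff) ω u
        · rw [if_pos hu, Set.indicator_of_mem
            (show ω ∈ X.sameHistory t ω₀ ∩ {ω | X.ElimBy (t + Tdiff) ω u} from ⟨hω, hu⟩)]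
        · rw [if_neg hu, Set.indicator_of_notMem fun hc => hu hc.2, zero_div]
      · rw [Set.indicator_of_notMem hω, Set.indicator_of_notMem hω,
          Finset.sum_eq_zero fun u _ => Set.indicator_of_notMem (fun hc => hω hc.1) _, sub_zero]
    · have hsub := integral_sub hi1 (integrable_finsetSum _ hi2)
      simp only [Pi.sub_apply] at hsub ⊢
      rw [hsub, integral_finsetSum _ hi2, integral_indicator_const _ hHm]
      simp only [integral_indicator_const _ (hEm _), smul_eq_mul]
      rw [← ha, hY, Finset.sum_div, mul_comm]
      congr 1
      exact Finset.sum_congr rfl fun u _ => by rw [hq]; ring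
  have hE : 0 ≤ X.numActive t ω₀ := Nat.cast_nonneg _
  have hY0 : 0 ≤ Y := Finset.sum_nonneg fun u _ => mul_nonneg (Nat.cast_nonneg _) measureReal_nonneg
  have hloss : X.numActive t ω₀ / 28 * (Tmin / Tdiff) * a ≤ Y / 2 := by
    have hxe : Tmin / Tdiff = (Tdiff / Tmin)⁻¹ := (inv_div _ _).symm
    rw [hxe]
    set x := Tdiff / Tmin
    have hx0 : 0 < x := by linarith
    have h1 : a / 8 * X.numActive t ω₀ ≤ (7 / 4 * x) * Y :=
      hgraph.trans (mul_le_mul_of_nonneg_right (by linarith) hY0)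
    rw [div_mul_eq_mul_div, ← div_eq_mul_inv, div_div, div_mul_eq_mul_div,
      div_le_div_iff₀ (by positivity) (by norm_num)]
    nlinarith
  linarith

end Execution
end Singing

namespace Singing
namespace Execution

variable {V : Type*} {G : SimpleGraph V} {Tmin Tmax Δmax : ℝ} (X : Execution G Tmin Tmax Δmax)

/-! ### Convergence with high probability -/

theorem numActive_eq_of_mem_sameHistory [Finite V] (h : Admissible Tmin Δmax) {t : ℝ}
    (ht : 0 ≤ t) {ω₀ ω : Coins V} (hω : ω ∈ X.sameHistory t ω₀) :
    X.numActive t ω = X.numActive t ω₀ := by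
  have hagr := X.agreeBefore_of_mem_sameHistory h hω
  rw [numActive, numActive, activeEdges, activeEdges]
  simp only [X.eliminated_iff h ht, hagr.elimBy_iff h]

/-- The expected loss in the next `Tdiff` units of time, averaged over the histories up to
time `t`. -/
theorem integral_numActive_add_le [Fintype V] [Nonempty V] (h : Admissible Tmin Δmax) {t : ℝ}
    (ht : 0 ≤ t) {Tdiff : ℝ} (hTd : Tdiff = 2 * Δmax + 3 * Tmax) :
    ∫ ω, X.numActive (t + Tdiff) ω ∂(coinMeasure V) ≤
      (1 - Tmin / Tdiff / 28) * ∫ ω, X.numActive t ω ∂(coinMeasure V) := by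
  have hT := h.Tmin_pos
  have hD := h.delay_nonneg
  have hTT := X.Tmin_le_Tmax (Classical.arbitrary V)
  let A : Set.range (X.sameHistory t) → Set (Coins V) := Subtype.val
  have hAm : ∀ i, MeasurableSet (A i) := by
    rintro ⟨_, ω₀, rfl⟩
    exact X.measurableSet_sameHistory h t ω₀
  have hmem : ∀ {ω ω₀}, ω ∈ X.sameHistory t ω₀ → X.sameHistory t ω = X.sameHistory t ω₀ := by
    intro ω ω₀ hω
    have : historyUpTo X.start t ω = historyUpTo X.start t ω₀ := hω
    rw [sameHistory, sameHistory, this]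
  have hAd : Pairwise (Function.onFun Disjoint A) := by
    rintro ⟨_, ω₁, rfl⟩ ⟨_, ω₂, rfl⟩ hne
    refine Set.disjoint_left.2 fun ω h1 h2 => hne (Subtype.ext ?_)
    exact (hmem h1).symm.trans (hmem h2)
  -- the histories are disjoint events of positive probability, hence countably many
  have hcount : Countable (Set.range (X.sameHistory t)) := by
    have := Measure.countable_meas_pos_of_disjoint_iUnion (μ := coinMeasure V) hAm hAd
    refine Set.countable_univ_iff.1 (this.mono fun i _ => ?_)
    obtain ⟨_, ω₀, rfl⟩ := i
    exact (ENNReal.toReal_pos_iff.1 (X.measureReal_sameHistory_pos h t ω₀)).1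
  have hAU : ⋃ i, A i = Set.univ := Set.eq_univ_of_forall fun ω =>
    Set.mem_iUnion.2 ⟨⟨_, ω, rfl⟩, rfl⟩
  have hsum : ∀ f : Coins V → ℝ, Integrable f (coinMeasure V) →
      HasSum (fun i => ∫ ω in A i, f ω ∂(coinMeasure V)) (∫ ω, f ω ∂(coinMeasure V)) := by
    intro f hf
    have := hasSum_integral_iUnion (μ := coinMeasure V) hAm hAd hf.integrableOn
    rwa [hAU, setIntegral_univ] at this
  refine hasSum_le ?_ (hsum _ (X.integrable_numActive h (by linarith)))
    ((hsum _ (X.integrable_numActive h ht)).mul_left _)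
  rintro ⟨_, ω₀, rfl⟩
  refine (X.setIntegral_numActive_le h ht ω₀ hTd).trans (le_of_eq ?_)
  have hconst : ∫ ω in X.sameHistory t ω₀, X.numActive t ω ∂(coinMeasure V) =
      (coinMeasure V).real (X.sameHistory t ω₀) * X.numActive t ω₀ := by
    rw [setIntegral_congr_fun (X.measurableSet_sameHistory h t ω₀)
      (fun ω hω => X.numActive_eq_of_mem_sameHistory h ht hω), setIntegral_const, smul_eq_mul]
  show _ = _ * ∫ ω in X.sameHistory t ω₀, X.numActive t ω ∂(coinMeasure V)
  rw [hconst]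
  ring

theorem numActive_le_card_sq [Fintype V] (t : ℝ) (ω : Coins V) :
    X.numActive t ω ≤ (Fintype.card V : ℝ) ^ 2 := by
  have h1 : (X.activeEdges t ω).ncard ≤ Nat.card (Sym2 V) := Set.ncard_le_card _
  have h2 : Nat.card (Sym2 V) ≤ Nat.card (V × V) :=
    Nat.card_le_card_of_surjective (Quot.mk _) Quot.mk_surjective
  rw [Nat.card_prod, Nat.card_eq_fintype_card (α := V), ← sq] at h2
  rw [numActive]
  exact_mod_cast h1.trans h2

theorem integral_numActive_le_pow [Fintype V] [Nonempty V] (h : Admissible Tmin Δmax)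
    {Tdiff : ℝ} (hTd : Tdiff = 2 * Δmax + 3 * Tmax) (k : ℕ) :
    ∫ ω, X.numActive (k * Tdiff) ω ∂(coinMeasure V) ≤
      (1 - Tmin / Tdiff / 28) ^ k * (Fintype.card V : ℝ) ^ 2 := by
  have hT := h.Tmin_pos
  have hD := h.delay_nonneg
  have hTT := X.Tmin_le_Tmax (Classical.arbitrary V)
  have hTdpos : 0 < Tdiff := by linarith
  have hθ : 0 ≤ 1 - Tmin / Tdiff / 28 := by
    have : Tmin / Tdiff ≤ 1 := (div_le_one hTdpos).2 (by linarith)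
    linarith
  induction k with
  | zero =>
    rw [pow_zero, one_mul]
    refine (integral_mono (X.integrable_numActive h (by simp)) (integrable_const _)
      fun ω => X.numActive_le_card_sq _ ω).trans ?_
    simp
  | succ k ih =>
    have hk : ((k + 1 : ℕ) : ℝ) * Tdiff = k * Tdiff + Tdiff := by push_cast; ring
    rw [hk, pow_succ', mul_assoc]
    exact (X.integral_numActive_add_le h (by positivity) hTd).trans
      (mul_le_mul_of_nonneg_left ih hθ)

/-- By Markov's inequality, the probability that the protocol has not converged is at most the
expected number of active edges some time before. -/
theorem measureReal_not_convergedBy_le [Fintype V] [Nonempty V] (h : Admissible Tmin Δmax)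
    {Tdiff : ℝ} (hTd : Tdiff = 2 * Δmax + 3 * Tmax) (k : ℕ) {T : ℝ}
    (hkT : k * Tdiff + 3 * Δmax + 4 * Tmax ≤ T) :
    (coinMeasure V).real {ω | ¬ X.ConvergedBy T ω} ≤
      (1 - Tmin / Tdiff / 28) ^ k * (Fintype.card V : ℝ) ^ 2 := by
  have hT := h.Tmin_pos
  have hD := h.delay_nonneg
  have hTT := X.Tmin_le_Tmax (Classical.arbitrary V)
  have hTdpos : 0 < Tdiff := by linarith
  have hk : (0 : ℝ) ≤ k * Tdiff := by positivity
  have hmarkov := mul_meas_ge_le_integral_of_nonneg (μ := coinMeasure V)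
    (Filter.Eventually.of_forall fun ω => (Nat.cast_nonneg _ : 0 ≤ X.numActive (k * Tdiff) ω))
    (X.integrable_numActive h hk) 1
  rw [one_mul] at hmarkov
  refine (measureReal_mono fun ω hω => ?_).trans
    (hmarkov.trans (X.integral_numActive_le_pow h hTd k))
  by_contra hcon
  refine hω (X.convergedBy_of_activeEdges_eq_empty h hk ?_ hkT (by linarith))
  have hlt : X.numActive (k * Tdiff) ω < 1 := not_le.1 hcon
  rw [numActive] at hlt
  have h0 : (X.activeEdges (k * Tdiff) ω).ncard = 0 := by
    have : (X.activeEdges (k * Tdiff) ω).ncard < 1 := by exact_mod_cast hlt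
    omega
  exact (Set.ncard_eq_zero (Set.toFinite _)).1 h0

theorem measure_not_convergedBy_le [Fintype V] (h : Admissible Tmin Δmax)
    (hV : 2 ≤ Fintype.card V) {c : ℝ} (hc : 1 ≤ c) :
    coinMeasure V {ω | ¬ X.ConvergedBy
        (1400 * c * Real.log (Fintype.card V) * (Tmax / Tmin) * Tmax) ω} ≤
      ENNReal.ofReal ((Fintype.card V : ℝ) ^ (-c)) := by
  have hne : Nonempty V := Fintype.card_pos_iff.1 (by omega)
  have hT := h.Tmin_pos
  have hD := h.delay_nonneg
  have h2D := h.two_delay_le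
  have hTT := X.Tmin_le_Tmax (Classical.arbitrary V)
  set n : ℝ := (Fintype.card V : ℝ) with hn
  have hn2 : 2 ≤ n := by rw [hn]; exact_mod_cast hV
  have hn0 : 0 < n := by linarith
  set L := Real.log n with hL
  have hL2 : 1 / 2 ≤ L := by
    have h1 := Real.log_le_log two_pos hn2
    have h2 := Real.log_two_gt_d9
    linarith
  obtain ⟨Tdiff, hTd⟩ : ∃ Tdiff, Tdiff = 2 * Δmax + 3 * Tmax := ⟨_, rfl⟩
  have hTdpos : 0 < Tdiff := by linarith
  have hTd4 : Tdiff ≤ 4 * Tmax := by linarith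
  set θ := Tmin / Tdiff / 28 with hθ
  have hθ0 : 0 < θ := by positivity
  have hc0 : 0 < c := by linarith
  have hL0 : 0 < L := by linarith
  have hcL : 0 < c * L := mul_pos hc0 hL0
  -- after `k` periods, the expected number of active edges is at most `n ^ 2 * n ^ (-3 * c)`
  set k := ⌈3 * c * L / θ⌉₊ with hk
  have hk1 : 3 * c * L ≤ k * θ := (div_le_iff₀ hθ0).1 (Nat.le_ceil _)
  have hk2 : (k : ℝ) ≤ 3 * c * L / θ + 1 := (Nat.ceil_lt_add_one (by positivity)).le
  have htime : k * Tdiff + 3 * Δmax + 4 * Tmax ≤ 1400 * c * L * (Tmax / Tmin) * Tmax := by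
    have h1 : (k : ℝ) * Tdiff ≤ (3 * c * L / θ + 1) * Tdiff :=
      mul_le_mul_of_nonneg_right hk2 hTdpos.le
    have h2 : 3 * c * L / θ * Tdiff = 84 * (c * L) * (Tdiff ^ 2 / Tmin) := by
      rw [hθ]
      field_simp
      ring
    have h3 : Tdiff ^ 2 / Tmin ≤ 16 * (Tmax / Tmin * Tmax) := by
      rw [div_mul_eq_mul_div, ← mul_div_assoc]
      gcongr
      nlinarith
    have h4 : Tmax ≤ Tmax / Tmin * Tmax :=
      le_mul_of_one_le_left (by linarith) ((one_le_div hT).2 hTT)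
    have hcL2 : 1 / 2 ≤ c * L := by nlinarith
    have h5 : 84 * (c * L) * (Tdiff ^ 2 / Tmin) ≤ 84 * (c * L) * (16 * (Tmax / Tmin * Tmax)) :=
      mul_le_mul_of_nonneg_left h3 (by positivity)
    have h6 : 1 / 2 * Tmax ≤ c * L * (Tmax / Tmin * Tmax) :=
      mul_le_mul hcL2 h4 (by linarith) hcL.le
    calc k * Tdiff + 3 * Δmax + 4 * Tmax
        ≤ 84 * (c * L) * (16 * (Tmax / Tmin * Tmax)) + 28 * (1 / 2 * Tmax) := by linarith
      _ ≤ 84 * (c * L) * (16 * (Tmax / Tmin * Tmax)) + 28 * (c * L * (Tmax / Tmin * Tmax)) := by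
          linarith
      _ ≤ 1400 * (c * L * (Tmax / Tmin * Tmax)) := by
          have : 0 ≤ c * L * (Tmax / Tmin * Tmax) := le_trans (by linarith) h6
          linarith
      _ = 1400 * c * L * (Tmax / Tmin) * Tmax := by ring
  have hbound : (1 - θ) ^ k * n ^ 2 ≤ n ^ (-c) := by
    have hθ1 : 0 ≤ 1 - θ := by
      have : Tmin / Tdiff ≤ 1 := (div_le_one hTdpos).2 (by linarith)
      rw [hθ]
      linarith
    have h1 : (1 - θ) ^ k ≤ Real.exp (-(k * θ)) := by
      rw [← mul_neg, Real.exp_nat_mul]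
      exact pow_le_pow_left₀ hθ1 (Real.one_sub_le_exp_neg θ) k
    have h2 : n ^ 2 = Real.exp (2 * L) := by
      rw [hL, mul_comm, Real.exp_mul, Real.exp_log hn0]
      norm_cast
    have h3 : n ^ (-c) = Real.exp (L * -c) := by rw [Real.rpow_def_of_pos hn0]
    rw [h2, h3]
    refine (mul_le_mul_of_nonneg_right h1 (Real.exp_pos _).le).trans ?_
    rw [← Real.exp_add]
    exact Real.exp_le_exp.2 (by nlinarith)
  rw [← ofReal_measureReal]
  exact ENNReal.ofReal_le_ofReal
    ((X.measureReal_not_convergedBy_le h hTd k htime).trans hbound)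

theorem numActive_of_isEmpty [IsEmpty V] : X.numActive = fun _ _ => 0 := by
  funext t ω
  have : X.activeEdges t ω = ∅ := by
    ext e
    induction e using Sym2.ind with
    | _ a b => exact isEmptyElim a
  rw [numActive, this]
  simp

/-- The expected loss, conditionally on the history. The network without agents is treated apart, as
`Tmax` may be negative then. -/
theorem numActive_div_le_sub_integral_cond [Fintype V] (h : Admissible Tmin Δmax) {t : ℝ}
    (ht : 0 ≤ t) (ω₀ : Coins V) {Tdiff : ℝ} (hTd : Tdiff = 2 * Δmax + 3 * Tmax) :
    X.numActive t ω₀ / 28 * (Tmin / Tdiff) ≤ X.numActive t ω₀ -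
      ∫ ω, X.numActive (t + Tdiff) ω
        ∂(ProbabilityTheory.cond (coinMeasure V) (X.sameHistory t ω₀)) := by
  rcases isEmpty_or_nonempty V with hV | hV
  · simp [X.numActive_of_isEmpty]
  · have hpos := X.measureReal_sameHistory_pos h t ω₀
    have hle := X.setIntegral_numActive_le h ht ω₀ hTd
    rw [ProbabilityTheory.cond, integral_smul_measure, ENNReal.toReal_inv, ← measureReal_def,
      smul_eq_mul, inv_mul_eq_div, le_sub_comm, div_le_iff₀ hpos]
    exact hle

theorem integrable_numActive_add [Fintype V] (h : Admissible Tmin Δmax) {t : ℝ} (ht : 0 ≤ t)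
    {Tdiff : ℝ} (hTd : Tdiff = 2 * Δmax + 3 * Tmax) :
    Integrable (X.numActive (t + Tdiff)) (coinMeasure V) := by
  rcases isEmpty_or_nonempty V with hV | hV
  · rw [X.numActive_of_isEmpty]
    exact integrable_const _
  · have hT := h.Tmin_pos
    have hD := h.delay_nonneg
    have hTT := X.Tmin_le_Tmax (Classical.arbitrary V)
    exact X.integrable_numActive h (by linarith)

end Execution
end Singing

theorem mainTheorem4 :
    (∀ (V : Type*) [Fintype V] (G : SimpleGraph V) (Tmin Tmax Δmax : ℝ),
      0 < Tmin → 0 ≤ Δmax → 2 * Δmax ≤ Tmin →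
      ∀ (X : Singing.Execution G Tmin Tmax Δmax) (Tdiff : ℝ), Tdiff = 2 * Δmax + 3 * Tmax →
      ∀ t : ℝ, 0 ≤ t →
        MeasureTheory.Integrable (X.numActive (t + Tdiff)) (Singing.coinMeasure V) ∧
        ∀ ω₀ : Singing.Coins V,
          MeasurableSet (X.sameHistory t ω₀) ∧
          Singing.coinMeasure V (X.sameHistory t ω₀) ≠ 0 ∧
          X.numActive t ω₀ / 28 * (Tmin / Tdiff) ≤
            X.numActive t ω₀ -
              ∫ ω, X.numActive (t + Tdiff) ω
                ∂(ProbabilityTheory.cond (Singing.coinMeasure V) (X.sameHistory t ω₀))) ∧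
    (∃ C : ℝ, 0 < C ∧
      ∀ (V : Type*) [Fintype V] (G : SimpleGraph V) (Tmin Tmax Δmax : ℝ),
      0 < Tmin → 0 ≤ Δmax → 2 * Δmax ≤ Tmin → 2 ≤ Fintype.card V →
      ∀ (X : Singing.Execution G Tmin Tmax Δmax) (c : ℝ), 1 ≤ c →
        Singing.coinMeasure V
            {ω | ¬ X.ConvergedBy
              (C * c * Real.log (Fintype.card V) * (Tmax / Tmin) * Tmax) ω} ≤
          ENNReal.ofReal ((Fintype.card V : ℝ) ^ (-c))) := by
  refine ⟨?_, 1400, by norm_num, ?_⟩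
  · intro V _ G Tmin Tmax Δmax hT hD h2D X Tdiff hTd t ht
    have h : Singing.Admissible Tmin Δmax := ⟨hT, hD, h2D⟩
    refine ⟨X.integrable_numActive_add h ht hTd, fun ω₀ =>
      ⟨X.measurableSet_sameHistory h t ω₀, fun h0 => ?_,
        X.numActive_div_le_sub_integral_cond h ht ω₀ hTd⟩⟩
    have hpos := X.measureReal_sameHistory_pos h t ω₀
    rw [MeasureTheory.measureReal_def, h0] at hpos
    exact lt_irrefl _ hpos
  · intro V _ G Tmin Tmax Δmax hT hD h2D hV X c hc
    exact X.measure_not_convergedBy_le ⟨hT, hD, h2D⟩ hV hc
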